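/- Let $M$ be a real analytic surface. A pair $(L,e)$, where $L$ is an analytic field of endomorphisms of $TM$ and $e$ an analytic vector field, is called a Nijenhuis operator with a unity if the Nijenhuis torsion $\mathcal N_L(\xi,\eta)=[L\xi,L\eta]+L^2[\xi,\eta]-L[L\xi,\eta]-L[\xi,L\eta]$ vanishes identically and $\mathcal L_eL=\mathrm{Id}$, where $\mathcal L_e$ is the Lie derivative. All coordinate systems, diffeomorphisms and functions below are real analytic. (a) If $(L,e)$ is a Nijenhuis operator with a unity on $M$ and $p\in M$, then there are local coordinates $(x,y)$ centred at $p$ in which $e=\partial_x$ and, for some $\lambda_0\in\mathbb R$, the matrix of $L$ is one of 1. $\begin{pmatrix}\lambda_0+x&0\\0&\lambda_0+x\end{pmatrix}$; 2. $\lambda_0\mathrm{Id}+\begin{pmatrix}x&-\frac12\\2(y+d)&x\end{pmatrix}$ with $d\in\mathbb R$; 3. $\lambda_0\mathrm{Id}+\begin{pmatrix}x&\mp\frac k2y^{k-1}\\\frac2ky&x\end{pmatrix}$ with an integer $k\ge1$ and one of the two signs; 4. $\lambda_0\mathrm{Id}+\begin{pmatrix}x&0\\f&x\end{pmatrix}$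 with $f=f(y)$ a function, analytic near $0$, of $y$ alone. Conversely, for all values of $\lambda_0$, $d$, $k\ge1$, the sign, and for every function $f(y)$ analytic near $0$, the operator in 1–4 together with $e=\partial_x$ is a Nijenhuis operator with a unity near the origin. (b) Let $\lambda_0\in\mathbb R$ and let $f(x,y)$, $\bar f(x,y)$ be analytic near $(0,0)$. There is a local diffeomorphism of $\mathbb R^2$ fixing the origin that transforms the operator $\lambda_0\mathrm{Id}+\begin{pmatrix}x&0\\f(x,y)&x\end{pmatrix}$ into $\lambda_0\mathrm{Id}+\begin{pmatrix}x&0\\\bar f(x,y)&x\end{pmatrix}$ near the origin if and only if there is a function $h(x,y)$, analytic near $(0,0)$, with $$h(0,0)=0,\qquad \frac{\partial h}{\partial y}(0,0)\ne0,\qquad \bar f(x,h(x,y))=\frac{\partial h}{\partial y}(x,y)\,f(x,y)\ \text{ near }(0,0).$$ If $f$ and $\bar f$ depend on $y$ alone, the same condition is also necessary and sufficient for the existence of such a diffeomorphism that in addition preserves $e=\partial_x$, that is, for the equivalence of the corresponding pairs $(L,e)$. -/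

import Mathlib

open scoped Manifold ContDiff Topology Bundle

noncomputable section

namespace NijenhuisUnity

/-- The coordinate plane `ℝ²`, with coordinates `x = u 0` and `y = u 1`. -/
abbrev Plane : Type := EuclideanSpace ℝ (Fin 2)

section Fields

variable (M : Type*) [TopologicalSpace M] [ChartedSpace Plane M]

/-- Vector fields on a surface (no regularity imposed). -/
abbrev VField : Type _ := ∀ q : M, TangentSpace (𝓡 2) q

/-- Operator fields, that is, fields of endomorphisms of the tangent spaces
(no regularity imposed). -/
abbrev OpField : Type _ := ∀ q : M, TangentSpace (𝓡 2) q →L[ℝ] TangentSpace (𝓡 2) q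

end Fields

section Manifold

variable {M : Type*} [TopologicalSpace M] [ChartedSpace Plane M]

/-- The vector field `ξ` is real analytic near `q`. -/
def AnalyticVFieldAt [IsManifold (𝓡 2) ω M] (ξ : VField M) (q : M) : Prop :=
  ContMDiffAt (𝓡 2) (𝓡 2).tangent ω (fun r => (⟨r, ξ r⟩ : TangentBundle (𝓡 2) M)) q

/-- The operator field `L` is real analytic, as a section of the bundle `End(TM)`. -/
def AnalyticOpField [IsManifold (𝓡 2) ω M] (L : OpField M) : Prop :=
  ContMDiff (𝓡 2) ((𝓡 2).prod 𝓘(ℝ, Plane →L[ℝ] Plane)) ω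
    (fun q => Bundle.TotalSpace.mk' (Plane →L[ℝ] Plane)
      (E := fun q : M => TangentSpace (𝓡 2) q →L[ℝ] TangentSpace (𝓡 2) q) q (L q))

/-- The vector field `L ξ`. -/
def OpField.app (L : OpField M) (ξ : VField M) : VField M := fun q => L q (ξ q)

/-- The value at `q` of the Nijenhuis torsion
`N_L(ξ, η) = [Lξ, Lη] + L²[ξ, η] - L[Lξ, η] - L[ξ, Lη]`. -/
def torsion (L : OpField M) (ξ η : VField M) (q : M) : TangentSpace (𝓡 2) q :=
  VectorField.mlieBracket (𝓡 2) (L.app ξ) (L.app η) q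
    + L q (L q (VectorField.mlieBracket (𝓡 2) ξ η q))
    - L q (VectorField.mlieBracket (𝓡 2) (L.app ξ) η q)
    - L q (VectorField.mlieBracket (𝓡 2) ξ (L.app η) q)

/-- The value at `q` of `(𝓛_e L) ξ = [e, Lξ] - L[e, ξ]`. -/
def lieDerivOp (e : VField M) (L : OpField M) (ξ : VField M) (q : M) : TangentSpace (𝓡 2) q :=
  VectorField.mlieBracket (𝓡 2) e (L.app ξ) q - L q (VectorField.mlieBracket (𝓡 2) e ξ q)

/-- The Nijenhuis torsion of `L` vanishes at `q`. -/
def TorsionFreeAt [IsManifold (𝓡 2) ω M] (L : OpField M) (q : M) : Prop :=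
  ∀ ξ η : VField M, AnalyticVFieldAt ξ q → AnalyticVFieldAt η q → torsion L ξ η q = 0

/-- The identity `𝓛_e L = Id` holds at `q`. -/
def UnityAt [IsManifold (𝓡 2) ω M] (L : OpField M) (e : VField M) (q : M) : Prop :=
  ∀ ξ : VField M, AnalyticVFieldAt ξ q → lieDerivOp e L ξ q = ξ q

/-- `(L, e)` is a real analytic Nijenhuis operator with a unity on the surface `M`. -/
structure IsNijenhuisWithUnity [IsManifold (𝓡 2) ω M] (L : OpField M) (e : VField M) : Prop where
  analytic_op : AnalyticOpField L
  analytic_field : ∀ q, AnalyticVFieldAt e q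
  torsion_free : ∀ q, TorsionFreeAt L q
  unity : ∀ q, UnityAt L e q

variable {N : Type*} [TopologicalSpace N] [ChartedSpace Plane N]

/-- `Φ` is an analytic diffeomorphism from a neighbourhood of `p` onto a neighbourhood of `p'`
which sends `p` to `p'`. For `N = ℝ²` and `p' = 0` these are the local analytic
coordinate systems centred at `p`. -/
structure IsLocalAnalyticDiffeo (Φ : OpenPartialHomeomorph M N) (p : M) (p' : N) : Prop where
  mem_source : p ∈ Φ.source
  map_point : Φ p = p'
  analytic : ContMDiffOn (𝓡 2) (𝓡 2) ω Φ Φ.source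
  analytic_symm : ContMDiffOn (𝓡 2) (𝓡 2) ω Φ.symm Φ.target

/-- `Φ` transforms the operator field `L` into `L'`. -/
def MapsOp (Φ : OpenPartialHomeomorph M N) (L : OpField M) (L' : OpField N) : Prop :=
  ∀ q ∈ Φ.source, ∀ v : TangentSpace (𝓡 2) q,
    mfderiv (𝓡 2) (𝓡 2) Φ q (L q v) = L' (Φ q) (mfderiv (𝓡 2) (𝓡 2) Φ q v)

/-- `Φ` transforms the vector field `e` into `e'`. -/
def MapsField (Φ : OpenPartialHomeomorph M N) (e : VField M) (e' : VField N) : Prop :=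
  ∀ q ∈ Φ.source, mfderiv (𝓡 2) (𝓡 2) Φ q (e q) = e' (Φ q)

/-- Local equivalence of `L` near `p` and `L'` near `p'`. -/
def OpEquiv (L : OpField M) (p : M) (L' : OpField N) (p' : N) : Prop :=
  ∃ Φ : OpenPartialHomeomorph M N, IsLocalAnalyticDiffeo Φ p p' ∧ MapsOp Φ L L'

/-- Local equivalence of the pair `(L, e)` near `p` and the pair `(L', e')` near `p'`. -/
def PairEquiv (L : OpField M) (e : VField M) (p : M)
    (L' : OpField N) (e' : VField N) (p' : N) : Prop :=
  ∃ Φ : OpenPartialHomeomorph M N,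
    IsLocalAnalyticDiffeo Φ p p' ∧ MapsOp Φ L L' ∧ MapsField Φ e e'

end Manifold

/-- The operator field on the plane with the matrix `A x y` at the point `(x, y)`; the columns
are the images of `∂_x` and `∂_y`. -/
def opOfMatrix (A : ℝ → ℝ → Matrix (Fin 2) (Fin 2) ℝ) : OpField Plane :=
  fun u => Matrix.toEuclideanCLM (n := Fin 2) (𝕜 := ℝ) (A (u 0) (u 1))

/-- The coordinate field `∂_x`. -/
def dX : VField Plane := fun _ => (!₂[(1 : ℝ), 0] : Plane)

def form₁ (l : ℝ) : OpField Plane :=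
  opOfMatrix fun x _ => !![l + x, 0; 0, l + x]

def form₂ (l d : ℝ) : OpField Plane :=
  opOfMatrix fun x y => !![l, 0; 0, l] + !![x, -(1 / 2); 2 * (y + d), x]

/-- The sign `s` is `1` or `-1`; the upper right entry is `∓ (k / 2) y ^ (k - 1)`. -/
def form₃ (l s : ℝ) (k : ℕ) : OpField Plane :=
  opOfMatrix fun x y =>
    !![l, 0; 0, l] + !![x, -s * ((k : ℝ) / 2) * y ^ (k - 1); (2 / (k : ℝ)) * y, x]

def form₄ (l : ℝ) (f : ℝ × ℝ → ℝ) : OpField Plane :=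
  opOfMatrix fun x y => !![l, 0; 0, l] + !![x, 0; f (x, y), x]

/-- There is an analytic function germ `h(x, y)` at the origin with `h(0, 0) = 0`,
`h_y(0, 0) ≠ 0` and `f'(x, h(x, y)) = h_y(x, y) f(x, y)` near the origin. -/
def ParamEquiv (f f' : ℝ × ℝ → ℝ) : Prop :=
  ∃ h : ℝ × ℝ → ℝ, AnalyticAt ℝ h (0, 0) ∧ h (0, 0) = 0 ∧
    deriv (fun t => h (0, t)) 0 ≠ 0 ∧
    ∀ᶠ z : ℝ × ℝ in 𝓝 (0, 0), f' (z.1, h z) = deriv (fun t => h (z.1, t)) z.2 * f z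

/-- Near the origin, `L` is Nijenhuis and `∂_x` is a unity for it. -/
def IsModelNearZero (L : OpField Plane) : Prop :=
  ∀ᶠ u : Plane in 𝓝 0, TorsionFreeAt L u ∧ UnityAt L dX u

end NijenhuisUnity

end

/-!
Half the trace of `L` has derivative `1` along the unity `e`, because `𝓛_e L = Id`; together with a
first integral of `e` it gives coordinates in which `e = ∂_x` and `tr L = 2(l + x)`. The first
integral at a point is found by following `e` from the point to a transversal hyperplane and
evaluating a linear functional there. It is analytic because the integral equation of the flow can
be solved by the implicit function theorem in a space of continuous curves, on which the
superposition operator `γ ↦ e ∘ γ` is analytic.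

Now `𝓛_e L = Id` says that `L - x Id` depends on `y` alone, and vanishing torsion forces the two
diagonal entries to agree. So `L` has diagonal `l + x` and off-diagonal entries `b(y)`, `c(y)`, and
the rest of the torsion is the single equation `(bc)' = 2b`. If `b` vanishes identically, this is
the fourth form. Otherwise put `bc` into normal form by a change of `y`: where `bc ≠ 0` at the
origin, its derivative `2b` is nonzero and `bc` is itself a coordinate up to a constant, which gives
the second form; where `bc = 0`, it becomes `∓y ^ k`, which gives the third.

Two operators of the fourth form have traces `2(l + x)`, so a diffeomorphism between them preserves
`x`; it is thus `(x, y) ↦ (x, h(x, y))`, and the lower left entry gives the equation for `h`.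
-/

noncomputable section

namespace NijenhuisUnity

/-! ### Superposition operators -/

section Superposition

variable {𝕜 K E F : Type*} [NontriviallyNormedField 𝕜] [TopologicalSpace K] [CompactSpace K]
  [NormedAddCommGroup E] [NormedSpace 𝕜 E] [NormedAddCommGroup F] [NormedSpace 𝕜 F]

/-- The pointwise action of a multilinear map on continuous functions. It turns the Taylor series
of a map `e` into that of the superposition operator `γ ↦ e ∘ γ`. -/
def liftMultilinear (K : Type*) [TopologicalSpace K] [CompactSpace K] {n : ℕ}
    (m : ContinuousMultilinearMap 𝕜 (fun _ : Fin n => E) F) :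
    ContinuousMultilinearMap 𝕜 (fun _ : Fin n => C(K, E)) C(K, F) :=
  MultilinearMap.mkContinuous
    { toFun := fun f => ⟨fun s => m fun i => f i s, by fun_prop⟩
      map_update_add' := fun f i a b => by
        ext s
        exact (m.compContinuousLinearMap fun _ => ContinuousMap.evalCLM 𝕜 s).map_update_add f i a b
      map_update_smul' := fun f i c a => by
        ext s
        exact (m.compContinuousLinearMap fun _ => ContinuousMap.evalCLM 𝕜 s).map_update_smul
          f i c a } ‖m‖
    fun f => (ContinuousMap.norm_le _ (by positivity)).2 fun s => (m.le_opNorm _).trans <| by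
      gcongr with i
      exact (f i).norm_coe_le_norm s

theorem norm_liftMultilinear_le {n : ℕ}
    (m : ContinuousMultilinearMap 𝕜 (fun _ : Fin n => E) F) : ‖liftMultilinear K m‖ ≤ ‖m‖ :=
  MultilinearMap.mkContinuous_norm_le _ (norm_nonneg _) _

theorem exists_analyticAt_superposition [CompleteSpace F] {e : E → F} {w : E}
    (he : AnalyticAt 𝕜 e w) :
    ∃ N : C(K, E) → C(K, F), AnalyticAt 𝕜 N (.const K w) ∧
      ∀ᶠ γ in 𝓝 (ContinuousMap.const K w), ∀ s, N γ s = e (γ s) := by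
  obtain ⟨p, r, hp⟩ := he
  let P : FormalMultilinearSeries 𝕜 C(K, E) C(K, F) := fun n => liftMultilinear K (p n)
  have hPr : r ≤ P.radius := hp.r_le.trans
    (FormalMultilinearSeries.radius_le_of_le fun n => norm_liftMultilinear_le (p n))
  have hP := (P.hasFPowerSeriesOnBall (hp.r_pos.trans_le hPr)).comp_sub (ContinuousMap.const K w)
  rw [zero_add] at hP
  refine ⟨fun γ => P.sum (γ - .const K w), hP.analyticAt, ?_⟩
  filter_upwards [Metric.eball_mem_nhds (ContinuousMap.const K w) hp.r_pos] with γ hγ s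
  rw [Metric.mem_eball, edist_eq_enorm_sub] at hγ
  have hle : ‖γ s - w‖ ≤ ‖γ - .const K w‖ := (γ - .const K w).norm_coe_le_norm s
  have hγs : ‖γ s - w‖ₑ < r := (enorm_le_iff_norm_le.2 hle).trans_lt hγ
  have hsum := hP.hasSum_sub (y := γ) (by
    rw [Metric.mem_eball, edist_eq_enorm_sub]; exact hγ.trans_le hPr)
  have hsum' := hp.hasSum_sub (y := γ s) (by rwa [Metric.mem_eball, edist_eq_enorm_sub])
  exact ((ContinuousMap.evalCLM 𝕜 s : C(K, F) →L[𝕜] F).hasSum hsum).unique hsum'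

end Superposition

/-! ### First integrals of analytic vector fields -/

section FirstIntegral

open unitInterval

variable {E F : Type*} [NormedAddCommGroup E] [NormedSpace ℝ E] [NormedAddCommGroup F]
  [NormedSpace ℝ F]

theorem fderiv_superposition_apply {K : Type*} [TopologicalSpace K] [CompactSpace K]
    {N : C(K, E) → C(K, F)} {e : E → F} {γ : C(K, E)} {s : K} (hN : DifferentiableAt ℝ N γ)
    (he : DifferentiableAt ℝ e (γ s)) (hNe : ∀ᶠ η in 𝓝 γ, N η s = e (η s)) (δ : C(K, E)) :
    fderiv ℝ N γ δ s = fderiv ℝ e (γ s) (δ s) := by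
  have h : HasFDerivAt (fun η => N η s) _ γ :=
    (ContinuousMap.evalCLM ℝ s : C(K, F) →L[ℝ] F).hasFDerivAt.comp γ hN.hasFDerivAt
  have h' : HasFDerivAt (fun η : C(K, E) => e (η s)) _ γ :=
    he.hasFDerivAt.comp γ (ContinuousMap.evalCLM ℝ s : C(K, E) →L[ℝ] E).hasFDerivAt
  exact congr($(h.unique (h'.congr_of_eventuallyEq hNe)) δ)

theorem exists_analyticAt_eq_add_smul {X Y : Type*} [NormedAddCommGroup X] [NormedSpace ℝ X]
    [CompleteSpace X] [NormedAddCommGroup Y] [NormedSpace ℝ Y] [CompleteSpace Y] (c : X →L[ℝ] Y)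
    {T : Y → Y} {x₀ : X} (hT : AnalyticAt ℝ T (c x₀)) :
    ∃ G : ℝ × X → Y, AnalyticAt ℝ G (0, x₀) ∧ G (0, x₀) = c x₀ ∧
      ∀ᶠ z in 𝓝 ((0, x₀) : ℝ × X), G z = c z.2 + z.1 • T (G z) := by
  let H : (ℝ × X) × Y → Y := fun a => a.2 - (c a.1.2 + a.1.1 • T a.2)
  have hTH : ContDiffAt ℝ ω (fun a : (ℝ × X) × Y => T a.2) ((0, x₀), c x₀) :=
    hT.contDiffAt.comp ((0, x₀), c x₀) contDiffAt_snd
  have hH : ContDiffAt ℝ ω H ((0, x₀), c x₀) :=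
    contDiffAt_snd.sub ((c.contDiff.contDiffAt.comp _ (by fun_prop)).add
      (ContDiffAt.smul (by fun_prop) hTH))
  have hω : (ω : ℕ∞ω) ≠ 0 := by simp
  have hH₀ : H ((0, x₀), c x₀) = 0 := by simp [H]
  have hinr : fderiv ℝ H ((0, x₀), c x₀) ∘L .inr ℝ (ℝ × X) Y = .id ℝ Y := by
    have hslice : HasFDerivAt (fun y : Y => H ((0, x₀), y))
        (fderiv ℝ H ((0, x₀), c x₀) ∘L .inr ℝ (ℝ × X) Y) (c x₀) :=
      (hH.differentiableAt hω).hasFDerivAt.comp (c x₀) (hasFDerivAt_prodMk_right (0, x₀) (c x₀))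
    refine hslice.unique ?_
    simpa only [H, zero_smul, add_zero, id] using (hasFDerivAt_id (c x₀)).sub_const (c x₀)
  have hinv : (fderiv ℝ H ((0, x₀), c x₀) ∘L .inr ℝ (ℝ × X) Y).IsInvertible :=
    hinr ▸ ⟨.refl ℝ Y, rfl⟩
  refine ⟨hH.implicitFunction hω hinv, (hH.contDiffAt_implicitFunction hω hinv).analyticAt,
    hH.implicitFunction_apply_self hω hinv, ?_⟩
  filter_upwards [hH.eventually_apply_implicitFunction hω hinv] with z hz
  exact sub_eq_zero.1 (hz.trans hH₀)

/-- The embedding of a space into the space of curves in it, as constant curves. -/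
def constCLM (E : Type*) [NormedAddCommGroup E] [NormedSpace ℝ E] : E →L[ℝ] C(I, E) :=
  LinearMap.mkContinuous
    { toFun := fun w => .const I w
      map_add' := fun _ _ => rfl
      map_smul' := fun _ _ => rfl } 1 fun w => by
    refine (ContinuousMap.norm_le _ (by positivity)).2 fun _ => ?_
    rw [one_mul]
    exact le_rfl

theorem constCLM_apply (w : E) : constCLM E w = .const I w := rfl

theorem continuous_comp_projIcc {X : Type*} [TopologicalSpace X] (γ : C(I, X)) :
    Continuous fun r : ℝ => γ (Set.projIcc 0 1 zero_le_one r) := by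
  fun_prop

/-- Integration of a curve from the left end point of the unit interval. The curve is extended
by constants to the real line, so as to use interval integrals. -/
def primitiveCLM (E : Type*) [NormedAddCommGroup E] [NormedSpace ℝ E] : C(I, E) →L[ℝ] C(I, E) :=
  LinearMap.mkContinuous
    { toFun := fun γ => ⟨fun s => ∫ r in (0 : ℝ)..s, γ (Set.projIcc 0 1 zero_le_one r),
        (intervalIntegral.continuous_primitive
          (fun _ _ => (continuous_comp_projIcc γ).intervalIntegrable _ _) 0).comp
          continuous_subtype_val⟩
      map_add' := fun γ η => ContinuousMap.ext fun _ => intervalIntegral.integral_add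
        ((continuous_comp_projIcc γ).intervalIntegrable _ _)
        ((continuous_comp_projIcc η).intervalIntegrable _ _)
      map_smul' := fun c _ => ContinuousMap.ext fun _ => intervalIntegral.integral_smul c _ } 1
    fun γ => (ContinuousMap.norm_le _ (by positivity)).2 fun s => by
      refine (intervalIntegral.norm_integral_le_of_norm_le_const
        (C := ‖γ‖) fun r _ => γ.norm_coe_le_norm _).trans ?_
      rw [sub_zero, abs_of_nonneg s.2.1, one_mul]
      exact mul_le_of_le_one_right (norm_nonneg _) s.2.2

theorem primitiveCLM_apply (γ : C(I, E)) (s : I) :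
    primitiveCLM E γ s = ∫ r in (0 : ℝ)..s, γ (Set.projIcc 0 1 zero_le_one r) := rfl

theorem hasDerivAt_integral_projIcc [CompleteSpace E] (γ : C(I, E)) (s : I) :
    HasDerivAt (fun t => ∫ r in (0 : ℝ)..t, γ (Set.projIcc 0 1 zero_le_one r)) (γ s) s := by
  have h := (continuous_comp_projIcc γ).integral_hasStrictDerivAt 0 (s : ℝ) |>.hasDerivAt
  rwa [Set.projIcc_val] at h

theorem primitiveCLM_eq_sub [CompleteSpace E] {f : ℝ → E} {γ : C(I, E)}
    (hf : ∀ s : I, HasDerivAt f (γ s) s) (s : I) : primitiveCLM E γ s = f s - f 0 := by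
  refine intervalIntegral.integral_eq_sub_of_hasDerivAt (fun r hr => ?_)
    ((continuous_comp_projIcc γ).intervalIntegrable _ _)
  rw [Set.uIcc_of_le s.2.1] at hr
  have hrI : r ∈ I := ⟨hr.1, hr.2.trans s.2.2⟩
  simpa only [Set.projIcc_of_mem zero_le_one hrI] using hf ⟨r, hrI⟩

theorem eq_of_eq_add_smul_apply {X : Type*} [NormedAddCommGroup X] [NormedSpace ℝ X]
    {T : X →L[ℝ] X} {t : ℝ} (hT : |t| * ‖T‖ < 1) {c x y : X} (hx : x = c + t • T x)
    (hy : y = c + t • T y) : x = y := by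
  have hfix : x - y = t • T (x - y) := by
    rw [map_sub, smul_sub]
    nth_rewrite 1 [hx, hy]
    abel
  have hle : ‖x - y‖ ≤ |t| * ‖T‖ * ‖x - y‖ := by
    nth_rewrite 1 [hfix]
    rw [norm_smul, Real.norm_eq_abs, mul_assoc]
    gcongr
    exact T.le_opNorm _
  have hnorm : ‖x - y‖ = 0 := by nlinarith [norm_nonneg (x - y)]
  exact sub_eq_zero.1 (norm_eq_zero.1 hnorm)

/-- The variation of an integral curve whose starting point moves along the field, while the
duration decreases at unit rate: it vanishes at the end point. -/
theorem one_sub_smul_eq_linearized_picard [CompleteSpace E] {e : E → E} {γ ν δ : C(I, E)} {w : E}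
    {t : ℝ} (hγ : γ = constCLM E w + t • primitiveCLM E ν) (hν : ∀ s, ν s = e (γ s))
    (he : ∀ s, DifferentiableAt ℝ e (γ s)) (hδ : ∀ s : I, δ s = (1 - (s : ℝ)) • ν s)
    {A : C(I, E) →L[ℝ] C(I, E)} (hA : ∀ η s, A η s = fderiv ℝ e (γ s) (η s)) :
    δ = constCLM E (e w) - primitiveCLM E ν + t • primitiveCLM E (A δ) := by
  let γ' : ℝ → E := fun r => w + t • ∫ u in (0 : ℝ)..r, ν (Set.projIcc 0 1 zero_le_one u)
  have hγ' (s : I) : γ' s = γ s := by rw [hγ]; rfl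
  have hγ'₀ : γ' 0 = w := by simp [γ']
  have hderiv (s : I) : HasDerivAt (fun r : ℝ => (1 - r) • e (γ' r)) ((t • A δ - ν) s) s := by
    have h : HasDerivAt γ' (t • ν s) s :=
      ((hasDerivAt_integral_projIcc ν s).const_smul t).const_add w
    have he' : HasDerivAt (fun r => e (γ' r)) (fderiv ℝ e (γ s) (t • ν s)) s :=
      (he s).hasFDerivAt.comp_hasDerivAt_of_eq (s : ℝ) h (hγ' s).symm
    refine (((hasDerivAt_id (s : ℝ)).const_sub 1).smul he').congr_deriv ?_
    simp only [id, ContinuousMap.sub_apply, ContinuousMap.smul_apply, hA, hδ, map_smul, hγ', hν]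
    module
  ext s
  have h := primitiveCLM_eq_sub hderiv s
  rw [hγ'₀, hγ', ← hν, ← hδ, sub_zero, one_smul, map_sub, map_smul, ContinuousMap.sub_apply,
    eq_sub_iff_add_eq] at h
  rw [ContinuousMap.add_apply, ContinuousMap.sub_apply, constCLM_apply, ContinuousMap.const_apply,
    ← h]
  abel

theorem primitiveCLM_constCLM [CompleteSpace E] (w : E) (s : I) :
    primitiveCLM E (constCLM E w) s = (s : ℝ) • w := by
  simp [primitiveCLM_apply, constCLM_apply]

theorem fderiv_apply_of_eq_add_smul {X Y : Type*} [NormedAddCommGroup X] [NormedSpace ℝ X]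
    [NormedAddCommGroup Y] [NormedSpace ℝ Y] {c : X →L[ℝ] Y} {T : Y → Y} {G : ℝ × X → Y}
    {z : ℝ × X} (hG : DifferentiableAt ℝ G z) (hT : DifferentiableAt ℝ T (G z))
    (hGT : ∀ᶠ z' in 𝓝 z, G z' = c z'.2 + z'.1 • T (G z')) (v : ℝ × X) :
    fderiv ℝ G z v = c v.2 + v.1 • T (G z) + z.1 • fderiv ℝ T (G z) (fderiv ℝ G z v) := by
  have hc : HasFDerivAt (fun z' : ℝ × X => c z'.2) _ z := c.hasFDerivAt.comp z hasFDerivAt_snd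
  have hTG : HasFDerivAt (fun z' => T (G z')) _ z := hT.hasFDerivAt.comp z hG.hasFDerivAt
  have h := (hc.add (hasFDerivAt_fst.smul hTG)).congr_of_eventuallyEq hGT
  refine congr($(h.fderiv) v).trans ?_
  simp only [add_apply, ContinuousLinearMap.comp_apply, smul_apply,
    ContinuousLinearMap.smulRight_apply, ContinuousLinearMap.coe_fst',
    ContinuousLinearMap.coe_snd']
  abel

theorem eventually_fderiv_eq_of_eq_add_smul {X Y : Type*} [NormedAddCommGroup X]
    [NormedSpace ℝ X] [NormedAddCommGroup Y] [NormedSpace ℝ Y] [CompleteSpace Y] {c : X →L[ℝ] Y}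
    {T : Y → Y} {G : ℝ × X → Y} {x₀ : X} (hG : AnalyticAt ℝ G (0, x₀))
    (hT : AnalyticAt ℝ T (G (0, x₀)))
    (hGT : ∀ᶠ z in 𝓝 ((0, x₀) : ℝ × X), G z = c z.2 + z.1 • T (G z)) :
    ∀ᶠ z in 𝓝 ((0, x₀) : ℝ × X), ∀ v y,
      y = c v.2 + v.1 • T (G z) + z.1 • fderiv ℝ T (G z) y → fderiv ℝ G z v = y := by
  have hcont : ContinuousAt (fun z : ℝ × X => |z.1| * ‖fderiv ℝ T (G z)‖) (0, x₀) :=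
    continuousAt_fst.abs.mul (hT.fderiv.continuousAt.comp hG.continuousAt).norm
  have hsmall : ∀ᶠ z in 𝓝 ((0, x₀) : ℝ × X), |z.1| * ‖fderiv ℝ T (G z)‖ < 1 :=
    hcont.eventually_lt continuousAt_const (by simp)
  filter_upwards [hG.eventually_analyticAt, hGT.eventually_nhds, hsmall,
    hG.continuousAt.eventually hT.eventually_analyticAt] with z hGz hGTz hsmallz hTz v y hy
  exact eq_of_eq_add_smul_apply hsmallz
    (fderiv_apply_of_eq_add_smul hGz.differentiableAt hTz.differentiableAt hGTz v) hy

theorem eventually_forall_apply {K X : Type*} [TopologicalSpace K] [CompactSpace K]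
    [TopologicalSpace X] {w : X} {p : X → Prop} (hp : ∀ᶠ x in 𝓝 w, p x) :
    ∀ᶠ γ in 𝓝 (ContinuousMap.const K w), ∀ s, p (γ s) := by
  obtain ⟨U, hU, hUo, hwU⟩ := eventually_nhds_iff.1 hp
  filter_upwards [ContinuousMap.eventually_mapsTo isCompact_univ hUo (f := .const K w)
    fun _ _ => hwU] with γ hγ s using hU _ (hγ (Set.mem_univ s))

theorem exists_analyticAt_fderiv_neg_one_eq_zero [CompleteSpace E] {e : E → E} {w₀ : E}
    (he : AnalyticAt ℝ e w₀) :
    ∃ Y : ℝ × E → E, AnalyticAt ℝ Y (0, w₀) ∧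
      (∀ v, fderiv ℝ Y (0, w₀) v = v.2 + v.1 • e w₀) ∧
      ∀ᶠ z in 𝓝 ((0, w₀) : ℝ × E), fderiv ℝ Y z (-1, e z.2) = 0 := by
  obtain ⟨N, hN, hNe⟩ := exists_analyticAt_superposition (K := I) he
  have hT : AnalyticAt ℝ (fun γ => primitiveCLM E (N γ)) (constCLM E w₀) :=
    ((primitiveCLM E).analyticAt _).comp hN
  obtain ⟨G, hG, hG₀, hGT⟩ := exists_analyticAt_eq_add_smul (constCLM E) hT
  have hY {z : ℝ × E} (hz : AnalyticAt ℝ G z) (v : ℝ × E) :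
      fderiv ℝ (fun z => G z 1) z v = fderiv ℝ G z v 1 :=
    congr($(((ContinuousMap.evalCLM ℝ 1 : C(I, E) →L[ℝ] E).hasFDerivAt.comp z
      hz.differentiableAt.hasFDerivAt).fderiv) v)
  refine ⟨fun z => G z 1,
    ((ContinuousMap.evalCLM ℝ 1 : C(I, E) →L[ℝ] E).analyticAt _).comp hG, fun v => ?_, ?_⟩
  · have hN₀ : N (constCLM E w₀) = constCLM E (e w₀) := ContinuousMap.ext hNe.self_of_nhds
    rw [hY hG, fderiv_apply_of_eq_add_smul hG.differentiableAt (hG₀ ▸ hT.differentiableAt) hGT,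
      hG₀, hN₀, zero_smul, add_zero, ContinuousMap.add_apply, ContinuousMap.smul_apply,
      primitiveCLM_constCLM, constCLM_apply, ContinuousMap.const_apply, Set.Icc.coe_one, one_smul]
  · have hG' : Filter.Tendsto G (𝓝 (0, w₀)) (𝓝 (constCLM E w₀)) := hG₀ ▸ hG.continuousAt
    filter_upwards [hG.eventually_analyticAt, hGT,
      eventually_fderiv_eq_of_eq_add_smul hG (hG₀ ▸ hT) hGT,
      hG'.eventually hN.eventually_analyticAt, hG'.eventually hNe.eventually_nhds,
      hG'.eventually (eventually_forall_apply he.eventually_analyticAt)]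
      with z hGz hGTz huniq hNz hNez hez
    set γ := G z
    let δ : C(I, E) := ⟨fun s => (1 - (s : ℝ)) • N γ s, by fun_prop⟩
    have hfderivT (η : C(I, E)) : fderiv ℝ (fun γ => primitiveCLM E (N γ)) γ η =
        primitiveCLM E (fderiv ℝ N γ η) :=
      congr($(((primitiveCLM E).hasFDerivAt.comp γ hNz.differentiableAt.hasFDerivAt).fderiv) η)
    have hδ := one_sub_smul_eq_linearized_picard (δ := δ) hGTz hNez.self_of_nhds
      (fun s => (hez s).differentiableAt) (fun _ => rfl) fun η s =>
        fderiv_superposition_apply hNz.differentiableAt (hez s).differentiableAt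
          (hNez.mono fun _ h => h s) η
    have hGδ : fderiv ℝ G z (-1, e z.2) = δ := huniq _ _ <| by
      rwa [hfderivT, neg_one_smul, ← sub_eq_add_neg]
    simp [hY hGz, hGδ, δ]

/-- With `φ e = 1`, follow the field from `u` for the time `- φ (u - w₀)` and apply `ℓ` to the
end point. -/
theorem exists_analyticAt_firstIntegral_of_eq_one [CompleteSpace E] {e : E → E} {w₀ : E}
    (he : AnalyticAt ℝ e w₀) {φ : E →L[ℝ] ℝ} (hφ : ∀ᶠ u in 𝓝 w₀, φ (e u) = 1) {ℓ : E →L[ℝ] F}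
    (hℓ : ℓ (e w₀) = 0) :
    ∃ J : E → F, AnalyticAt ℝ J w₀ ∧ J w₀ = 0 ∧ fderiv ℝ J w₀ = ℓ ∧
      ∀ᶠ u in 𝓝 w₀, fderiv ℝ J u (e u) = 0 := by
  obtain ⟨Y, hY, hY₀, hYe⟩ := exists_analyticAt_fderiv_neg_one_eq_zero he
  let z : E → ℝ × E := fun u => (-φ (u - w₀), u)
  have hzw₀ : z w₀ = (0, w₀) := by simp [z]
  have hz (u : E) : HasFDerivAt z ((-φ).prod (.id ℝ E)) u :=
    ((φ.hasFDerivAt.comp u ((hasFDerivAt_id u).sub_const w₀)).neg).prodMk (hasFDerivAt_id u)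
  have hza : AnalyticAt ℝ z w₀ :=
    ((φ.analyticAt _).comp (analyticAt_id.sub analyticAt_const)).neg.prod analyticAt_id
  have hYz : AnalyticAt ℝ (fun u => ℓ (Y (z u))) w₀ :=
    (ℓ.analyticAt _).comp (AnalyticAt.comp (hzw₀.symm ▸ hY) hza)
  have hderiv {u : E} (hu : AnalyticAt ℝ Y (z u)) (v : E) :
      fderiv ℝ (fun u => ℓ (Y (z u)) - ℓ (Y (0, w₀))) u v = ℓ (fderiv ℝ Y (z u) (-φ v, v)) :=
    congr($(((ℓ.hasFDerivAt.comp u (hu.differentiableAt.hasFDerivAt.comp u (hz u))).sub_const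
      _).fderiv) v)
  have hzt : Filter.Tendsto z (𝓝 w₀) (𝓝 (0, w₀)) := hzw₀ ▸ hza.continuousAt
  refine ⟨fun u => ℓ (Y (z u)) - ℓ (Y (0, w₀)), hYz.sub analyticAt_const, by simp [hzw₀], ?_, ?_⟩
  · ext v
    rw [hderiv (hzw₀.symm ▸ hY), hzw₀, hY₀, map_add, map_smul, hℓ, smul_zero, add_zero]
  · filter_upwards [hφ, hzt.eventually hY.eventually_analyticAt, hzt.eventually hYe]
      with u hφu hYu hYeu
    rw [hderiv hYu, hφu]
    exact (congrArg ℓ hYeu).trans (map_zero ℓ)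

theorem exists_analyticAt_firstIntegral [CompleteSpace E] {e : E → E} {w₀ : E}
    (he : AnalyticAt ℝ e w₀) (he₀ : e w₀ ≠ 0) {ℓ : E →L[ℝ] F} (hℓ : ℓ (e w₀) = 0) :
    ∃ J : E → F, AnalyticAt ℝ J w₀ ∧ J w₀ = 0 ∧ fderiv ℝ J w₀ = ℓ ∧
      ∀ᶠ u in 𝓝 w₀, fderiv ℝ J u (e u) = 0 := by
  obtain ⟨φ, hφ⟩ := SeparatingDual.exists_eq_one (R := ℝ) he₀
  have hφe : AnalyticAt ℝ (fun u => φ (e u)) w₀ := (φ.analyticAt _).comp he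
  have hne : ∀ᶠ u in 𝓝 w₀, φ (e u) ≠ 0 := hφe.continuousAt.eventually_ne (by simp [hφ])
  obtain ⟨J, hJ, hJ₀, hJℓ, hJe⟩ := exists_analyticAt_firstIntegral_of_eq_one (φ := φ) (ℓ := ℓ)
    (e := fun u => (φ (e u))⁻¹ • e u) ((hφe.inv (by simp [hφ])).smul he)
    (hne.mono fun u hu => by simp [hu]) (by simp [hℓ])
  refine ⟨J, hJ, hJ₀, hJℓ, ?_⟩
  filter_upwards [hne, hJe] with u hu hJu
  rw [map_smul] at hJu
  exact (smul_eq_zero.1 hJu).resolve_left (inv_ne_zero hu)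

end FirstIntegral

/-! ### Maps into the plane -/

theorem plane_ext {u v : Plane} (h0 : u 0 = v 0) (h1 : u 1 = v 1) : u = v := by
  ext i
  fin_cases i
  exacts [h0, h1]

/-- The coordinates on the plane, as linear functionals. -/
def coord (i : Fin 2) : Plane →L[ℝ] ℝ := EuclideanSpace.proj i

@[simp] theorem coord_apply (i : Fin 2) (u : Plane) : coord i u = u i := rfl

theorem hasFDerivAt_coord (i : Fin 2) (u : Plane) :
    HasFDerivAt (fun u : Plane => u i) (coord i) u := (coord i).hasFDerivAt

theorem analyticAt_coord (i : Fin 2) (u : Plane) : AnalyticAt ℝ (fun u : Plane => u i) u :=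
  (coord i).analyticAt u

section MapsToPlane

variable {E : Type*} [NormedAddCommGroup E] [NormedSpace ℝ E] {f g : E → ℝ} {z : E}

theorem hasFDerivAt_mk {f' g' : E →L[ℝ] ℝ} (hf : HasFDerivAt f f' z) (hg : HasFDerivAt g g' z) :
    HasFDerivAt (fun x => (!₂[f x, g x] : Plane))
      (f'.smulRight !₂[1, 0] + g'.smulRight !₂[0, 1]) z := by
  refine ((hf.smul_const (!₂[1, 0] : Plane)).add (hg.smul_const !₂[0, 1])).congr_of_eventuallyEq
    (.of_forall fun x => plane_ext ?_ ?_) <;> simp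

theorem fderiv_mk_apply (hf : DifferentiableAt ℝ f z) (hg : DifferentiableAt ℝ g z) (v : E) :
    fderiv ℝ (fun x => (!₂[f x, g x] : Plane)) z v = !₂[fderiv ℝ f z v, fderiv ℝ g z v] := by
  rw [(hasFDerivAt_mk hf.hasFDerivAt hg.hasFDerivAt).fderiv]
  refine plane_ext ?_ ?_ <;> simp

theorem analyticAt_mk (hf : AnalyticAt ℝ f z) (hg : AnalyticAt ℝ g z) :
    AnalyticAt ℝ (fun x => (!₂[f x, g x] : Plane)) z := by
  refine ((hf.smul (analyticAt_const (v := (!₂[1, 0] : Plane)))).add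
    (hg.smul (analyticAt_const (v := !₂[0, 1])))).congr
      (.of_forall fun x => plane_ext ?_ ?_) <;> simp

end MapsToPlane

/-! ### Local analytic diffeomorphisms -/

section LocalDiffeo

theorem exists_isLocalAnalyticDiffeo {F : Plane → Plane} {u₀ u₁ : Plane} {P : Plane → Prop}
    (hF : AnalyticAt ℝ F u₀) (hF₀ : F u₀ = u₁) (hinj : Function.Injective (fderiv ℝ F u₀))
    (hP : ∀ᶠ u in 𝓝 u₀, P u) :
    ∃ Φ : OpenPartialHomeomorph Plane Plane,
      IsLocalAnalyticDiffeo Φ u₀ u₁ ∧ ⇑Φ = F ∧ ∀ u ∈ Φ.source, P u := by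
  let A : Plane ≃L[ℝ] Plane :=
    (LinearEquiv.ofInjectiveEndo (fderiv ℝ F u₀ : Plane →ₗ[ℝ] Plane) hinj).toContinuousLinearEquiv
  have hA : HasFDerivAt F (A : Plane →L[ℝ] Plane) u₀ := hF.differentiableAt.hasFDerivAt
  have hc : ContDiffAt ℝ ω F u₀ := hF.contDiffAt
  let Ψ := hc.toOpenPartialHomeomorph F hA (by simp)
  let Φ := (Ψ.restrContDiff ℝ ω (by simp)).restr {u | P u}
  have hsource : Φ.source ⊆ (Ψ.restrContDiff ℝ ω (by simp)).source := by
    rw [OpenPartialHomeomorph.restr_source]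
    exact Set.inter_subset_left
  have htarget : Φ.target ⊆ (Ψ.restrContDiff ℝ ω (by simp)).target := fun u hu => hu.1
  refine ⟨Φ, ⟨?_, hF₀, ?_, ?_⟩, rfl, fun u hu => ?_⟩
  · rw [OpenPartialHomeomorph.restr_source]
    exact ⟨⟨hc.mem_toOpenPartialHomeomorph_source hA (by simp), hc,
      hc.to_localInverse hA (by simp)⟩, mem_interior_iff_mem_nhds.2 hP⟩
  · exact ((Ψ.contDiffOn_restrContDiff_source ℝ (by simp)).mono hsource).contMDiffOn
  · exact ((Ψ.contDiffOn_restrContDiff_target ℝ (by simp)).mono htarget).contMDiffOn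
  · rw [OpenPartialHomeomorph.restr_source] at hu
    exact interior_subset hu.2

variable {M : Type*} [TopologicalSpace M] [ChartedSpace Plane M]
  {N : Type*} [TopologicalSpace N] [ChartedSpace Plane N]
  {P : Type*} [TopologicalSpace P] [ChartedSpace Plane P]
  {Φ : OpenPartialHomeomorph M N} {Ψ : OpenPartialHomeomorph N P} {p q : M} {p' : N} {p'' : P}

theorem isLocalAnalyticDiffeo_chartAt [IsManifold (𝓡 2) ω M] (p : M) :
    IsLocalAnalyticDiffeo (chartAt Plane p) p (chartAt Plane p p) where
  mem_source := mem_chart_source _ p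
  map_point := rfl
  analytic := contMDiffOn_chart
  analytic_symm := contMDiffOn_chart_symm

namespace IsLocalAnalyticDiffeo

theorem restr (h : IsLocalAnalyticDiffeo Φ p p') {s : Set M} (hs : s ∈ 𝓝 p) :
    IsLocalAnalyticDiffeo (Φ.restr s) p p' where
  mem_source := by
    rw [OpenPartialHomeomorph.restr_source]
    exact ⟨h.mem_source, mem_interior_iff_mem_nhds.2 hs⟩
  map_point := h.map_point
  analytic := h.analytic.mono (by
    rw [OpenPartialHomeomorph.restr_source]
    exact Set.inter_subset_left)
  analytic_symm := h.analytic_symm.mono fun _ hu => hu.1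

theorem trans (h : IsLocalAnalyticDiffeo Φ p p') (h' : IsLocalAnalyticDiffeo Ψ p' p'') :
    IsLocalAnalyticDiffeo (Φ.trans Ψ) p p'' where
  mem_source := by
    rw [OpenPartialHomeomorph.trans_source]
    exact ⟨h.mem_source, by simpa only [Set.mem_preimage, h.map_point] using h'.mem_source⟩
  map_point := by simp only [OpenPartialHomeomorph.coe_trans, Function.comp_apply, h.map_point,
    h'.map_point]
  analytic := by
    rw [OpenPartialHomeomorph.coe_trans, OpenPartialHomeomorph.trans_source]
    exact h'.analytic.comp (h.analytic.mono Set.inter_subset_left) fun _ hu => hu.2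
  analytic_symm := by
    rw [OpenPartialHomeomorph.coe_trans_symm, OpenPartialHomeomorph.trans_target]
    exact h.analytic_symm.comp (h'.analytic_symm.mono Set.inter_subset_left) fun _ hu => hu.2

theorem contMDiffAt (h : IsLocalAnalyticDiffeo Φ p p') (hq : q ∈ Φ.source) :
    ContMDiffAt (𝓡 2) (𝓡 2) ω Φ q :=
  h.analytic.contMDiffAt (Φ.open_source.mem_nhds hq)

theorem mdifferentiable (h : IsLocalAnalyticDiffeo Φ p p') : Φ.MDifferentiable (𝓡 2) (𝓡 2) :=
  ⟨h.analytic.mdifferentiableOn (by simp), h.analytic_symm.mdifferentiableOn (by simp)⟩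

theorem isInvertible_mfderiv (h : IsLocalAnalyticDiffeo Φ p p') (hq : q ∈ Φ.source) :
    (mfderiv (𝓡 2) (𝓡 2) Φ q).IsInvertible :=
  ⟨h.mdifferentiable.mfderiv hq, rfl⟩

theorem eventually_nhds_iff (h : IsLocalAnalyticDiffeo Φ p p') {Q : N → Prop} :
    (∀ᶠ r in 𝓝 p', Q r) ↔ ∀ᶠ q in 𝓝 p, Q (Φ q) := by
  rw [← h.map_point, ← Φ.map_nhds_eq h.mem_source, Filter.eventually_map]

end IsLocalAnalyticDiffeo

/-! ### Local equivalence -/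

variable {L : OpField M} {L' : OpField N} {e : VField M} {e' : VField N}

theorem PairEquiv.opEquiv (h : PairEquiv L e p L' e' p') : OpEquiv L p L' p' :=
  let ⟨Φ, hΦ, hL, _⟩ := h
  ⟨Φ, hΦ, hL⟩

theorem PairEquiv.trans {L'' : OpField P} {e'' : VField P} (h : PairEquiv L e p L' e' p')
    (h' : PairEquiv L' e' p' L'' e'' p'') : PairEquiv L e p L'' e'' p'' := by
  obtain ⟨Φ, hΦ, hL, he⟩ := h
  obtain ⟨Ψ, hΨ, hL', he'⟩ := h'
  have hsource {q : M} (hq : q ∈ (Φ.trans Ψ).source) : q ∈ Φ.source ∧ Φ q ∈ Ψ.source := by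
    rwa [OpenPartialHomeomorph.trans_source] at hq
  have hchain {q : M} (hq : q ∈ (Φ.trans Ψ).source) (v : TangentSpace (𝓡 2) q) :
      mfderiv (𝓡 2) (𝓡 2) (Φ.trans Ψ) q v =
        mfderiv (𝓡 2) (𝓡 2) Ψ (Φ q) (mfderiv (𝓡 2) (𝓡 2) Φ q v) :=
    congr($(mfderiv_comp q (hΨ.mdifferentiable.mdifferentiableAt (hsource hq).2)
      (hΦ.mdifferentiable.mdifferentiableAt (hsource hq).1)) v)
  refine ⟨Φ.trans Ψ, hΦ.trans hΨ, fun q hq v => ?_, fun q hq => ?_⟩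
  · rw [hchain hq, hchain hq, hL q (hsource hq).1, hL' _ (hsource hq).2]
    rfl
  · rw [hchain hq, he q (hsource hq).1, he' _ (hsource hq).2]
    rfl

theorem PairEquiv.congr_right {L'' : OpField N} {e'' : VField N} (h : PairEquiv L e p L' e' p')
    (hL : ∀ᶠ r in 𝓝 p', L' r = L'' r) (he : ∀ᶠ r in 𝓝 p', e' r = e'' r) :
    PairEquiv L e p L'' e'' p' := by
  obtain ⟨Φ, hΦ, hΦL, hΦe⟩ := h
  let s : Set M := {q | L' (Φ q) = L'' (Φ q) ∧ e' (Φ q) = e'' (Φ q)}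
  have hs : s ∈ 𝓝 p := hΦ.eventually_nhds_iff.1 (hL.and he)
  have hsource {q : M} (hq : q ∈ (Φ.restr s).source) : q ∈ Φ.source ∧ q ∈ s := by
    rw [OpenPartialHomeomorph.restr_source] at hq
    exact ⟨hq.1, interior_subset hq.2⟩
  refine ⟨_, hΦ.restr hs, fun q hq v => ?_, fun q hq => ?_⟩
  · exact (hΦL q (hsource hq).1 v).trans congr($((hsource hq).2.1) _)
  · exact (hΦe q (hsource hq).1).trans (hsource hq).2.2

end LocalDiffeo

section PlaneEquiv

variable {L L' : OpField Plane} {e e' : VField Plane} {F : Plane → Plane} {u₀ u₁ : Plane}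

theorem OpEquiv.of_eventually (hF : AnalyticAt ℝ F u₀) (hF₀ : F u₀ = u₁)
    (hinj : Function.Injective (fderiv ℝ F u₀))
    (hL : ∀ᶠ u in 𝓝 u₀, ∀ v : Plane, fderiv ℝ F u (L u v) = L' (F u) (fderiv ℝ F u v)) :
    OpEquiv L u₀ L' u₁ := by
  obtain ⟨Φ, hΦ, rfl, hΦL⟩ := exists_isLocalAnalyticDiffeo hF hF₀ hinj hL
  exact ⟨Φ, hΦ, fun u hu v => by
    rw [mfderiv_eq_fderiv]
    exact hΦL u hu v⟩

theorem PairEquiv.of_eventually (hF : AnalyticAt ℝ F u₀) (hF₀ : F u₀ = u₁)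
    (hinj : Function.Injective (fderiv ℝ F u₀))
    (hL : ∀ᶠ u in 𝓝 u₀, ∀ v : Plane, fderiv ℝ F u (L u v) = L' (F u) (fderiv ℝ F u v))
    (he : ∀ᶠ u in 𝓝 u₀, fderiv ℝ F u (e u) = e' (F u)) :
    PairEquiv L e u₀ L' e' u₁ := by
  obtain ⟨Φ, hΦ, rfl, h⟩ := exists_isLocalAnalyticDiffeo hF hF₀ hinj (hL.and he)
  refine ⟨Φ, hΦ, fun u hu v => ?_, fun u hu => ?_⟩ <;> rw [mfderiv_eq_fderiv]
  exacts [(h u hu).1 v, (h u hu).2]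

end PlaneEquiv

/-! ### Naturality of the torsion and of the Lie derivative -/

section Naturality

open VectorField

variable {M : Type*} [TopologicalSpace M] [ChartedSpace Plane M]
  {N : Type*} [TopologicalSpace N] [ChartedSpace Plane N]
  {Φ : OpenPartialHomeomorph M N} {p q : M} {p' : N}
  {L : OpField M} {L' : OpField N} {e : VField M} {e' : VField N}

/-- The pullback of an operator field by a map, matching `VectorField.mpullback`. -/
def pullbackOp (f : M → N) (L : OpField N) : OpField M := fun q =>
  (mfderiv (𝓡 2) (𝓡 2) f q).inverse ∘L L (f q) ∘L mfderiv (𝓡 2) (𝓡 2) f q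

theorem IsLocalAnalyticDiffeo.mfderiv_symm_apply (hΦ : IsLocalAnalyticDiffeo Φ p p')
    (hq : q ∈ Φ.source) (v : TangentSpace (𝓡 2) q) :
    mfderiv (𝓡 2) (𝓡 2) Φ.symm (Φ q) (mfderiv (𝓡 2) (𝓡 2) Φ q v) = v :=
  congr($(hΦ.mdifferentiable.symm_comp_deriv hq) v)

theorem IsLocalAnalyticDiffeo.symm (hΦ : IsLocalAnalyticDiffeo Φ p p') :
    IsLocalAnalyticDiffeo Φ.symm p' p where
  mem_source := hΦ.map_point ▸ Φ.map_source hΦ.mem_source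
  map_point := by rw [← hΦ.map_point, Φ.left_inv hΦ.mem_source]
  analytic := hΦ.analytic_symm
  analytic_symm := hΦ.analytic

theorem mapsOp_pullbackOp (hΦ : IsLocalAnalyticDiffeo Φ p p') (L : OpField N) :
    MapsOp Φ (pullbackOp Φ L) L :=
  fun _ hq _ => (hΦ.isInvertible_mfderiv hq).self_apply_inverse _

theorem mapsField_mpullback (hΦ : IsLocalAnalyticDiffeo Φ p p') (e : VField N) :
    MapsField Φ (mpullback (𝓡 2) (𝓡 2) Φ e) e :=
  fun _ hq => (hΦ.isInvertible_mfderiv hq).self_apply_inverse _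

theorem MapsOp.symm (hL : MapsOp Φ L L') (hΦ : IsLocalAnalyticDiffeo Φ p p') :
    MapsOp Φ.symm L' L := by
  intro r hr w
  obtain ⟨q, hq, rfl⟩ : ∃ q ∈ Φ.source, Φ q = r := ⟨_, Φ.map_target hr, Φ.right_inv hr⟩
  obtain ⟨v, rfl⟩ := (hΦ.isInvertible_mfderiv hq).surjective w
  rw [← hL q hq, hΦ.mfderiv_symm_apply hq, hΦ.mfderiv_symm_apply hq, Φ.left_inv hq]

theorem MapsField.symm (he : MapsField Φ e e') (hΦ : IsLocalAnalyticDiffeo Φ p p') :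
    MapsField Φ.symm e' e := by
  intro r hr
  obtain ⟨q, hq, rfl⟩ : ∃ q ∈ Φ.source, Φ q = r := ⟨_, Φ.map_target hr, Φ.right_inv hr⟩
  rw [← he q hq, hΦ.mfderiv_symm_apply hq, Φ.left_inv hq]

theorem MapsOp.app {ξ : VField M} {ξ' : VField N} (hL : MapsOp Φ L L') (hξ : MapsField Φ ξ ξ') :
    MapsField Φ (L.app ξ) (L'.app ξ') := fun q hq => by
  rw [OpField.app, OpField.app, hL q hq, hξ q hq]

theorem MapsField.mpullback_eq (he : MapsField Φ e e') (hΦ : IsLocalAnalyticDiffeo Φ p p')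
    (hq : q ∈ Φ.source) : mpullback (𝓡 2) (𝓡 2) Φ e' q = e q := by
  rw [mpullback_apply, (hΦ.isInvertible_mfderiv hq).inverse_apply_eq, he q hq]

variable [IsManifold (𝓡 2) ω M] [IsManifold (𝓡 2) ω N]

theorem MapsField.analyticVFieldAt (he : MapsField Φ e e') (hΦ : IsLocalAnalyticDiffeo Φ p p')
    (hq : q ∈ Φ.source) (h : AnalyticVFieldAt e' (Φ q)) : AnalyticVFieldAt e q := by
  have hpull : AnalyticVFieldAt (mpullback (𝓡 2) (𝓡 2) Φ e') q :=
    ContMDiffAt.mpullback_vectorField_preimage h (hΦ.contMDiffAt hq) (hΦ.isInvertible_mfderiv hq)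
      le_rfl
  refine ContMDiffAt.congr_of_eventuallyEq hpull ?_
  filter_upwards [Φ.open_source.mem_nhds hq] with r hr
  rw [he.mpullback_eq hΦ hr]

theorem MapsField.analyticVFieldAt_iff (he : MapsField Φ e e')
    (hΦ : IsLocalAnalyticDiffeo Φ p p') (hq : q ∈ Φ.source) :
    AnalyticVFieldAt e q ↔ AnalyticVFieldAt e' (Φ q) := by
  refine ⟨fun h => ?_, he.analyticVFieldAt hΦ hq⟩
  rw [← Φ.left_inv hq] at h
  exact (he.symm hΦ).analyticVFieldAt hΦ.symm (Φ.map_source hq) h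

theorem MapsField.mfderiv_mlieBracket {ξ η : VField M} {ξ' η' : VField N}
    (hξ : MapsField Φ ξ ξ') (hη : MapsField Φ η η') (hΦ : IsLocalAnalyticDiffeo Φ p p')
    (hq : q ∈ Φ.source) (hξ' : AnalyticVFieldAt ξ' (Φ q)) (hη' : AnalyticVFieldAt η' (Φ q)) :
    mfderiv (𝓡 2) (𝓡 2) Φ q (mlieBracket (𝓡 2) ξ η q) = mlieBracket (𝓡 2) ξ' η' (Φ q) := by
  have : IsManifold (𝓡 2) (minSmoothness ℝ 2) M := .of_le (n := ω) le_top
  have : IsManifold (𝓡 2) (minSmoothness ℝ 2) N := .of_le (n := ω) le_top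
  have hpull := mpullback_mlieBracket (n := ω) (hξ'.mdifferentiableAt (by simp))
    (hη'.mdifferentiableAt (by simp)) (hΦ.contMDiffAt hq) le_top
  have heq : ∀ᶠ r in 𝓝 q, mpullback (𝓡 2) (𝓡 2) Φ ξ' r = ξ r ∧
      mpullback (𝓡 2) (𝓡 2) Φ η' r = η r :=
    Filter.eventually_of_mem (Φ.open_source.mem_nhds hq) fun r hr =>
      ⟨hξ.mpullback_eq hΦ hr, hη.mpullback_eq hΦ hr⟩
  rw [Filter.EventuallyEq.mlieBracket_vectorField_eq (heq.mono fun _ => And.left)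
    (heq.mono fun _ => And.right)] at hpull
  rw [← hpull, mpullback_apply, (hΦ.isInvertible_mfderiv hq).self_apply_inverse]

/-- The conditions of `IsNijenhuisWithUnity` near a single point. Analyticity of `L` is expressed
by its action on vector fields, which is how it enters the torsion and the Lie derivative. -/
structure IsNijenhuisWithUnityAt (L : OpField M) (e : VField M) (q : M) : Prop where
  analytic_app : ∀ ξ : VField M, AnalyticVFieldAt ξ q → AnalyticVFieldAt (L.app ξ) q
  analytic_field : AnalyticVFieldAt e q
  torsion_free : TorsionFreeAt L q
  unity : UnityAt L e q

theorem IsNijenhuisWithUnity.isNijenhuisWithUnityAt (h : IsNijenhuisWithUnity L e) (q : M) :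
    IsNijenhuisWithUnityAt L e q where
  analytic_app _ hξ := ContMDiffAt.clm_bundle_apply (h.analytic_op q) hξ
  analytic_field := h.analytic_field q
  torsion_free := h.torsion_free q
  unity := h.unity q

theorem IsNijenhuisWithUnityAt.map (h : IsNijenhuisWithUnityAt L e q)
    (hΦ : IsLocalAnalyticDiffeo Φ p p') (hL : MapsOp Φ L L') (he : MapsField Φ e e')
    (hq : q ∈ Φ.source) : IsNijenhuisWithUnityAt L' e' (Φ q) := by
  have hpull (ξ : VField N) : MapsField Φ (mpullback (𝓡 2) (𝓡 2) Φ ξ) ξ :=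
    mapsField_mpullback hΦ ξ
  have hL' (v : TangentSpace (𝓡 2) q) : L' (Φ q) (mfderiv (𝓡 2) (𝓡 2) Φ q v) =
    mfderiv (𝓡 2) (𝓡 2) Φ q (L q v) := (hL q hq v).symm
  have happ (ξ : VField N) (hξ : AnalyticVFieldAt ξ (Φ q)) : AnalyticVFieldAt (L'.app ξ) (Φ q) :=
    ((hL.app (hpull ξ)).analyticVFieldAt_iff hΦ hq).1 <|
      h.analytic_app _ (((hpull ξ).analyticVFieldAt_iff hΦ hq).2 hξ)
  have he' : AnalyticVFieldAt e' (Φ q) := (he.analyticVFieldAt_iff hΦ hq).1 h.analytic_field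
  refine ⟨happ, he', fun ξ η hξ hη => ?_, fun ξ hξ => ?_⟩
  · have htorsion := h.torsion_free _ _ (((hpull ξ).analyticVFieldAt_iff hΦ hq).2 hξ)
      (((hpull η).analyticVFieldAt_iff hΦ hq).2 hη)
    rw [torsion, ← (hL.app (hpull ξ)).mfderiv_mlieBracket (hL.app (hpull η)) hΦ hq
      (happ ξ hξ) (happ η hη), ← (hpull ξ).mfderiv_mlieBracket (hpull η) hΦ hq hξ hη,
      ← (hL.app (hpull ξ)).mfderiv_mlieBracket (hpull η) hΦ hq (happ ξ hξ) hη,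
      ← (hpull ξ).mfderiv_mlieBracket (hL.app (hpull η)) hΦ hq hξ (happ η hη),
      hL', hL', hL', hL', ← map_add, ← map_sub, ← map_sub]
    exact (congrArg _ htorsion).trans (map_zero _)
  · have hunity := h.unity _ (((hpull ξ).analyticVFieldAt_iff hΦ hq).2 hξ)
    rw [lieDerivOp, ← he.mfderiv_mlieBracket (hL.app (hpull ξ)) hΦ hq he' (happ ξ hξ),
      ← he.mfderiv_mlieBracket (hpull ξ) hΦ hq he' hξ, hL', ← map_sub]
    exact (congrArg _ hunity).trans (hpull ξ q hq)

end Naturality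

/-! ### Torsion and Lie derivative in coordinates -/

section Coordinates

variable {E : Type*} [NormedAddCommGroup E] [NormedSpace ℝ E]

/-- The Nijenhuis torsion of an operator field on a vector space, in terms of its derivative. -/
def coordTorsion (L : E → E →L[ℝ] E) (u v w : E) : E :=
  fderiv ℝ L u (L u v) w - fderiv ℝ L u (L u w) v - L u (fderiv ℝ L u v w)
    + L u (fderiv ℝ L u w v)

/-- The Lie derivative `𝓛_e L` of an operator field on a vector space, in terms of derivatives. -/
def coordLieDeriv (e : E → E) (L : E → E →L[ℝ] E) (u : E) : E →L[ℝ] E :=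
  fderiv ℝ L u (e u) - fderiv ℝ e u ∘L L u + L u ∘L fderiv ℝ e u

theorem fderiv_app {L : E → E →L[ℝ] E} {ξ : E → E} {u : E}
    (hL : DifferentiableAt ℝ L u) (hξ : DifferentiableAt ℝ ξ u) (v : E) :
    fderiv ℝ (fun u => L u (ξ u)) u v = fderiv ℝ L u v (ξ u) + L u (fderiv ℝ ξ u v) := by
  rw [(hL.hasFDerivAt.clm_apply hξ.hasFDerivAt).fderiv]
  simp [add_comm]

theorem mlieBracket_plane :
    (VectorField.mlieBracket (𝓡 2) : (Plane → Plane) → (Plane → Plane) → Plane → Plane) =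
      VectorField.lieBracket ℝ := by
  funext ξ η u
  exact congrFun (VectorField.mlieBracketWithin_univ.symm.trans <|
    VectorField.mlieBracketWithin_eq_lieBracketWithin.trans VectorField.lieBracketWithin_univ) u

theorem torsion_plane {L : Plane → Plane →L[ℝ] Plane} {ξ η : Plane → Plane} {u : Plane}
    (hL : DifferentiableAt ℝ L u) (hξ : DifferentiableAt ℝ ξ u) (hη : DifferentiableAt ℝ η u) :
    torsion (M := Plane) L ξ η u = coordTorsion L u (ξ u) (η u) := by
  have hbracket := congrArg (fun B : (Plane → Plane) → (Plane → Plane) → Plane → Plane =>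
    B (fun u => L u (ξ u)) (fun u => L u (η u)) u + L u (L u (B ξ η u)) -
      L u (B (fun u => L u (ξ u)) η u) - L u (B ξ (fun u => L u (η u)) u)) mlieBracket_plane
  refine hbracket.trans ?_
  simp only [VectorField.lieBracket, fderiv_app hL hξ, fderiv_app hL hη, coordTorsion, map_sub,
    map_add]
  abel

theorem lieDerivOp_plane {L : Plane → Plane →L[ℝ] Plane} {e ξ : Plane → Plane} {u : Plane}
    (hL : DifferentiableAt ℝ L u) (hξ : DifferentiableAt ℝ ξ u) :
    lieDerivOp (M := Plane) e L ξ u = coordLieDeriv e L u (ξ u) := by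
  have hbracket := congrArg (fun B : (Plane → Plane) → (Plane → Plane) → Plane → Plane =>
    B e (fun u => L u (ξ u)) u - L u (B e ξ u)) mlieBracket_plane
  refine hbracket.trans ?_
  simp only [VectorField.lieBracket, fderiv_app hL hξ, coordLieDeriv, map_sub, add_apply,
    sub_apply, ContinuousLinearMap.comp_apply]
  abel

theorem analyticVFieldAt_iff_analyticAt {ξ : Plane → Plane} {u : Plane} :
    AnalyticVFieldAt (M := Plane) ξ u ↔ AnalyticAt ℝ ξ u :=
  contMDiffAt_vectorSpace_iff_contDiffAt.trans
    ⟨ContDiffAt.analyticAt, AnalyticAt.contDiffAt⟩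

theorem torsionFreeAt_plane_iff {L : Plane → Plane →L[ℝ] Plane} {u : Plane}
    (hL : DifferentiableAt ℝ L u) :
    TorsionFreeAt (M := Plane) L u ↔ ∀ v w, coordTorsion L u v w = 0 := by
  refine ⟨fun h v w => ?_, fun h ξ η hξ hη => ?_⟩
  · have hconst (v : Plane) :=
      analyticVFieldAt_iff_analyticAt.2 (analyticAt_const (v := v) (x := u))
    exact (torsion_plane hL (differentiableAt_const v) (differentiableAt_const w)).symm.trans
      (h _ _ (hconst v) (hconst w))
  · replace hξ := analyticVFieldAt_iff_analyticAt.1 hξ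
    replace hη := analyticVFieldAt_iff_analyticAt.1 hη
    exact (torsion_plane hL hξ.differentiableAt hη.differentiableAt).trans (h _ _)

theorem unityAt_plane_iff {L : Plane → Plane →L[ℝ] Plane} {e : Plane → Plane} {u : Plane}
    (hL : DifferentiableAt ℝ L u) :
    UnityAt (M := Plane) L e u ↔ coordLieDeriv e L u = .id ℝ Plane := by
  refine ⟨fun h => ?_, fun h ξ hξ => ?_⟩
  · ext1 v
    exact (lieDerivOp_plane hL (differentiableAt_const v)).symm.trans
      (h _ (analyticVFieldAt_iff_analyticAt.2 analyticAt_const))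
  · replace hξ := analyticVFieldAt_iff_analyticAt.1 hξ
    exact (lieDerivOp_plane hL hξ.differentiableAt).trans congr($h _)

theorem analyticAt_clm_of_apply [FiniteDimensional ℝ E] {F G : Type*} [NormedAddCommGroup F]
    [NormedSpace ℝ F] [NormedAddCommGroup G] [NormedSpace ℝ G] {L : F → E →L[ℝ] G} {z : F}
    (h : ∀ v, AnalyticAt ℝ (fun z => L z v) z) : AnalyticAt ℝ L z := by
  let b := Module.finBasis ℝ E
  have hexpand (A : E →L[ℝ] G) : ∑ i, ContinuousLinearMap.smulRightL ℝ E G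
      (LinearMap.toContinuousLinearMap (b.coord i)) (A (b i)) = A := by
    ext v
    conv_rhs => rw [← b.sum_repr v, map_sum]
    simp
  refine (Finset.analyticAt_fun_sum Finset.univ fun i _ => ?_).congr
    (.of_forall fun z => hexpand (L z))
  exact ((ContinuousLinearMap.smulRightL ℝ E G _).analyticAt _).fun_comp (h (b i))

theorem IsNijenhuisWithUnityAt.analyticAt_op {L : Plane → Plane →L[ℝ] Plane} {e : Plane → Plane}
    {u : Plane} (h : IsNijenhuisWithUnityAt (M := Plane) L e u) : AnalyticAt ℝ L u :=
  analyticAt_clm_of_apply fun _ => analyticVFieldAt_iff_analyticAt.1 <|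
    h.analytic_app _ (analyticVFieldAt_iff_analyticAt.2 analyticAt_const)

theorem IsNijenhuisWithUnityAt.analyticAt_field {L : Plane → Plane →L[ℝ] Plane}
    {e : Plane → Plane} {u : Plane} (h : IsNijenhuisWithUnityAt (M := Plane) L e u) :
    AnalyticAt ℝ e u :=
  analyticVFieldAt_iff_analyticAt.1 h.analytic_field

/-- The trace of an operator, as a continuous linear functional. -/
def traceCLM (E : Type*) [NormedAddCommGroup E] [NormedSpace ℝ E] [FiniteDimensional ℝ E] :
    (E →L[ℝ] E) →L[ℝ] ℝ :=
  LinearMap.toContinuousLinearMap (LinearMap.trace ℝ E ∘ₗ ContinuousLinearMap.coeLM ℝ)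

theorem traceCLM_comp_comm [FiniteDimensional ℝ E] (A B : E →L[ℝ] E) :
    traceCLM E (A ∘L B) = traceCLM E (B ∘L A) :=
  LinearMap.trace_mul_comm ℝ (A : E →ₗ[ℝ] E) (B : E →ₗ[ℝ] E)

theorem traceCLM_id [FiniteDimensional ℝ E] :
    traceCLM E (.id ℝ E) = Module.finrank ℝ E :=
  LinearMap.trace_id ℝ E

theorem traceCLM_eq_of_comp_eq [FiniteDimensional ℝ E] {A B T : E →L[ℝ] E}
    (hT : T.IsInvertible) (h : T ∘L A = B ∘L T) : traceCLM E A = traceCLM E B := by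
  obtain ⟨T, rfl⟩ := hT
  have hB : B = (T : E →L[ℝ] E) ∘L A ∘L (T.symm : E →L[ℝ] E) := by
    rw [← ContinuousLinearMap.comp_assoc, h, ContinuousLinearMap.comp_assoc,
      T.coe_comp_coe_symm, ContinuousLinearMap.comp_id]
  rw [hB, traceCLM_comp_comm, ContinuousLinearMap.comp_assoc, T.coe_symm_comp_coe,
    ContinuousLinearMap.comp_id]

theorem fderiv_traceCLM_apply_of_coordLieDeriv_eq_id [FiniteDimensional ℝ E] {L : E → E →L[ℝ] E}
    {e : E → E} {u : E} (hL : DifferentiableAt ℝ L u) (h : coordLieDeriv e L u = .id ℝ E) :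
    fderiv ℝ (fun u => traceCLM E (L u)) u (e u) = Module.finrank ℝ E := by
  have htrace := congrArg (traceCLM E) h
  rw [coordLieDeriv, map_add, map_sub, traceCLM_comp_comm (L u), traceCLM_id,
    sub_add_cancel] at htrace
  have hderiv : HasFDerivAt (fun u => traceCLM E (L u)) (traceCLM E ∘L fderiv ℝ L u) u :=
    (traceCLM E).hasFDerivAt.comp u hL.hasFDerivAt
  rw [hderiv.fderiv]
  exact htrace

end Coordinates

/-! ### Straightening the unity -/

section Straightening

/-- The coordinate vector `∂_x`, that is, the value of the field `dX`. -/
abbrev ex : Plane := !₂[1, 0]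

/-- The coordinate vector `∂_y`. -/
abbrev ey : Plane := !₂[0, 1]

/-- The linear functional `v ↦ det (w, v)`. -/
def wedge (w : Plane) : Plane →L[ℝ] ℝ := w 0 • coord 1 - w 1 • coord 0

theorem wedge_apply (w v : Plane) : wedge w v = w 0 * v 1 - w 1 * v 0 := rfl

theorem eq_zero_of_wedge_apply_eq_zero {X : Plane →L[ℝ] ℝ} {w v : Plane} (hw : X w = 1)
    (hXv : X v = 0) (hwv : wedge w v = 0) : v = 0 := by
  rw [wedge_apply] at hwv
  have h0 : w 0 • v = v 0 • w := plane_ext (mul_comm _ _)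
    (by simp only [PiLp.smul_apply, smul_eq_mul]; linarith)
  have h1 : w 1 • v = v 1 • w := plane_ext
    (by simp only [PiLp.smul_apply, smul_eq_mul]; linarith) (mul_comm _ _)
  refine plane_ext ?_ ?_
  · simpa [hw, hXv] using congrArg X h0.symm
  · simpa [hw, hXv] using congrArg X h1.symm

theorem exists_isLocalAnalyticDiffeo_mapsField_dX {t : Plane → ℝ} {e : Plane → Plane}
    {u₀ : Plane} (ht : AnalyticAt ℝ t u₀) (he : AnalyticAt ℝ e u₀)
    (hte : ∀ᶠ u in 𝓝 u₀, fderiv ℝ t u (e u) = 1) :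
    ∃ Φ : OpenPartialHomeomorph Plane Plane, IsLocalAnalyticDiffeo Φ u₀ 0 ∧
      MapsField (M := Plane) Φ e dX ∧ ∀ u, Φ u 0 = t u - t u₀ := by
  have he₀ : e u₀ ≠ 0 := fun h => by simpa [h] using hte.self_of_nhds
  obtain ⟨J, hJ, hJ₀, hJ', hJe⟩ := exists_analyticAt_firstIntegral he he₀
    (ℓ := wedge (e u₀)) (by rw [wedge_apply]; ring)
  let X : Plane → ℝ := fun u => t u - t u₀
  have hX : AnalyticAt ℝ X u₀ := ht.sub analyticAt_const
  have hX' (u : Plane) : fderiv ℝ X u = fderiv ℝ t u := fderiv_sub_const _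
  have hinj : Function.Injective (fderiv ℝ (fun u => (!₂[X u, J u] : Plane)) u₀) := by
    refine (injective_iff_map_eq_zero _).2 fun v hv => ?_
    rw [fderiv_mk_apply hX.differentiableAt hJ.differentiableAt, hX', hJ'] at hv
    exact eq_zero_of_wedge_apply_eq_zero hte.self_of_nhds (congrArg (· 0) hv) (congrArg (· 1) hv)
  have hstraight : ∀ᶠ u in 𝓝 u₀, fderiv ℝ (fun u => (!₂[X u, J u] : Plane)) u (e u) = ex := by
    filter_upwards [hte, hJe, hX.eventually_analyticAt, hJ.eventually_analyticAt]
      with u htu hJu hXu hJu'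
    rw [fderiv_mk_apply hXu.differentiableAt hJu'.differentiableAt, hX', htu, hJu, ex]
  obtain ⟨Φ, hΦ, hcoe, hΦe⟩ := exists_isLocalAnalyticDiffeo (analyticAt_mk hX hJ)
    (plane_ext (by simp [X]) (by simp [hJ₀]) : _ = (0 : Plane)) hinj hstraight
  refine ⟨Φ, hΦ, fun u hu => ?_, fun u => congr($hcoe u 0)⟩
  rw [mfderiv_eq_fderiv, hcoe]
  exact hΦe u hu

variable {M : Type*} [TopologicalSpace M] [ChartedSpace Plane M] [IsManifold (𝓡 2) ω M]
  {N : Type*} [TopologicalSpace N] [ChartedSpace Plane N] [IsManifold (𝓡 2) ω N]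
  {L : OpField M} {e : VField M} {p : M} {L' : OpField N} {e' : VField N} {p' : N}

theorem eventually_isNijenhuisWithUnityAt_map {Φ : OpenPartialHomeomorph M N}
    (h : ∀ᶠ q in 𝓝 p, IsNijenhuisWithUnityAt L e q) (hΦ : IsLocalAnalyticDiffeo Φ p p')
    (hL : MapsOp Φ L L') (he : MapsField Φ e e') :
    ∀ᶠ r in 𝓝 p', IsNijenhuisWithUnityAt L' e' r := by
  rw [hΦ.eventually_nhds_iff]
  filter_upwards [h, Φ.open_source.mem_nhds hΦ.mem_source] with q hq hmem
  exact hq.map hΦ hL he hmem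

theorem exists_pairEquiv_plane (h : ∀ᶠ q in 𝓝 p, IsNijenhuisWithUnityAt L e q) :
    ∃ (L' : OpField Plane) (e' : VField Plane) (u₀ : Plane), PairEquiv L e p L' e' u₀ ∧
      ∀ᶠ u in 𝓝 u₀, IsNijenhuisWithUnityAt L' e' u := by
  have hΦ := isLocalAnalyticDiffeo_chartAt p
  have hL := (mapsOp_pullbackOp hΦ.symm L).symm hΦ.symm
  have he := (mapsField_mpullback hΦ.symm e).symm hΦ.symm
  exact ⟨_, _, _, ⟨_, hΦ, hL, he⟩, eventually_isNijenhuisWithUnityAt_map h hΦ hL he⟩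

theorem IsNijenhuisWithUnityAt.fderiv_traceCLM_apply {L : Plane → Plane →L[ℝ] Plane}
    {e : Plane → Plane} {u : Plane} (h : IsNijenhuisWithUnityAt (M := Plane) L e u) :
    fderiv ℝ (fun u => traceCLM Plane (L u)) u (e u) = 2 := by
  have hL := h.analyticAt_op.differentiableAt
  rw [fderiv_traceCLM_apply_of_coordLieDeriv_eq_id hL ((unityAt_plane_iff hL).1 h.unity),
    finrank_euclideanSpace_fin, Nat.cast_ofNat]

theorem MapsOp.traceCLM_eq {A B : Plane → Plane →L[ℝ] Plane}
    {Φ : OpenPartialHomeomorph Plane Plane} {u₀ u₁ u : Plane}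
    (h : MapsOp (M := Plane) (N := Plane) Φ A B) (hΦ : IsLocalAnalyticDiffeo Φ u₀ u₁)
    (hu : u ∈ Φ.source) : traceCLM Plane (B (Φ u)) = traceCLM Plane (A u) :=
  (traceCLM_eq_of_comp_eq (E := Plane) (A := A u) (B := B (Φ u)) (hΦ.isInvertible_mfderiv hu)
    (ContinuousLinearMap.ext fun v => h u hu v)).symm

theorem exists_pairEquiv_dX_of_plane {A : Plane → Plane →L[ℝ] Plane} {b : Plane → Plane}
    {u₀ : Plane} (h : ∀ᶠ u in 𝓝 u₀, IsNijenhuisWithUnityAt (M := Plane) A b u) :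
    ∃ (l : ℝ) (A' : Plane → Plane →L[ℝ] Plane),
      PairEquiv (M := Plane) (N := Plane) A b u₀ A' dX 0 ∧
      ∀ᶠ u in 𝓝 0, IsNijenhuisWithUnityAt (M := Plane) A' dX u ∧
        traceCLM Plane (A' u) = 2 * (l + u 0) := by
  let t : Plane → ℝ := fun u => 2⁻¹ * traceCLM Plane (A u)
  have htrace {u : Plane} (hu : IsNijenhuisWithUnityAt (M := Plane) A b u) :
      AnalyticAt ℝ (fun u => traceCLM Plane (A u)) u :=
    ((traceCLM Plane).analyticAt _).fun_comp hu.analyticAt_op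
  have ht : AnalyticAt ℝ t u₀ := analyticAt_const.mul (htrace h.self_of_nhds)
  have htb : ∀ᶠ u in 𝓝 u₀, fderiv ℝ t u (b u) = 1 := by
    filter_upwards [h] with u hu
    rw [fderiv_const_mul (htrace hu).differentiableAt, smul_apply, hu.fderiv_traceCLM_apply]
    norm_num
  obtain ⟨Φ, hΦ, he, hΦ0⟩ := exists_isLocalAnalyticDiffeo_mapsField_dX ht
    h.self_of_nhds.analyticAt_field htb
  obtain ⟨A', hA⟩ : ∃ A' : Plane → Plane →L[ℝ] Plane, MapsOp (M := Plane) (N := Plane) Φ A A' :=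
    ⟨_, (mapsOp_pullbackOp hΦ.symm (A : OpField Plane)).symm hΦ.symm⟩
  refine ⟨t u₀, A', ⟨Φ, hΦ, hA, he⟩,
    (eventually_isNijenhuisWithUnityAt_map h hΦ hA he).and ?_⟩
  rw [hΦ.eventually_nhds_iff]
  filter_upwards [Φ.open_source.mem_nhds hΦ.mem_source] with u hu
  rw [hA.traceCLM_eq hΦ hu, hΦ0, add_sub_cancel]
  simp only [t]
  ring

theorem exists_pairEquiv_dX (h : ∀ᶠ q in 𝓝 p, IsNijenhuisWithUnityAt L e q) :
    ∃ (l : ℝ) (A : Plane → Plane →L[ℝ] Plane), PairEquiv L e p A dX 0 ∧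
      ∀ᶠ u in 𝓝 0, IsNijenhuisWithUnityAt (M := Plane) A dX u ∧
        traceCLM Plane (A u) = 2 * (l + u 0) := by
  obtain ⟨L₁, e₁, u₀, hequiv, h₁⟩ := exists_pairEquiv_plane h
  obtain ⟨l, A, hA, hgerm⟩ := exists_pairEquiv_dX_of_plane h₁
  exact ⟨l, A, hequiv.trans hA, hgerm⟩

end Straightening

/-! ### Operators with diagonal `l + x` -/

section NormalOp

theorem eq_smul_ex_add_smul_ey (u : Plane) : u = u 0 • ex + u 1 • ey :=
  plane_ext (by simp) (by simp)

theorem apply_eq_smul_ex_add_smul_ey {F : Type*} [NormedAddCommGroup F] [NormedSpace ℝ F]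
    (A : Plane →L[ℝ] F) (v : Plane) : A v = v 0 • A ex + v 1 • A ey := by
  conv_lhs => rw [eq_smul_ex_add_smul_ey v, map_add, map_smul, map_smul]

theorem traceCLM_plane (A : Plane →L[ℝ] Plane) : traceCLM Plane A = A ex 0 + A ey 1 := by
  have hbasis : EuclideanSpace.single 0 1 = ex ∧ EuclideanSpace.single 1 1 = ey :=
    ⟨plane_ext (by simp) (by simp), plane_ext (by simp) (by simp)⟩
  refine (LinearMap.trace_eq_matrix_trace ℝ (EuclideanSpace.basisFun (Fin 2) ℝ).toBasis
    (A : Plane →ₗ[ℝ] Plane)).trans ?_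
  simp [Matrix.trace, LinearMap.toMatrix_apply, hbasis]

/-- The operator field with the matrix `(l + x, b(y); c(y), l + x)`; all four normal forms are of
this kind. It is written in terms of operators so as to be easily differentiated. -/
def normalOp (l : ℝ) (b c : ℝ → ℝ) : Plane → Plane →L[ℝ] Plane := fun u =>
  (l + u 0) • .id ℝ Plane + b (u 1) • (coord 1).smulRight ex + c (u 1) • (coord 0).smulRight ey

theorem normalOp_apply (l : ℝ) (b c : ℝ → ℝ) (u v : Plane) : normalOp l b c u v =
    !₂[(l + u 0) * v 0 + b (u 1) * v 1, c (u 1) * v 0 + (l + u 0) * v 1] :=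
  plane_ext (by simp [normalOp]) (by simp [normalOp, add_comm])

theorem opOfMatrix_apply (A : ℝ → ℝ → Matrix (Fin 2) (Fin 2) ℝ) (u v : Plane) :
    opOfMatrix A u v = (!₂[A (u 0) (u 1) 0 0 * v 0 + A (u 0) (u 1) 0 1 * v 1,
      A (u 0) (u 1) 1 0 * v 0 + A (u 0) (u 1) 1 1 * v 1] : Plane) := by
  have h (i : Fin 2) : Matrix.toEuclideanCLM (n := Fin 2) (𝕜 := ℝ) (A (u 0) (u 1)) v i =
      A (u 0) (u 1) i 0 * v 0 + A (u 0) (u 1) i 1 * v 1 := by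
    simp [Matrix.ofLp_toEuclideanCLM, Matrix.mulVec, dotProduct]
  exact plane_ext (h 0) (h 1)

theorem opOfMatrix_eq_normalOp {l : ℝ} {b c : ℝ → ℝ} {A : ℝ → ℝ → Matrix (Fin 2) (Fin 2) ℝ}
    (h : ∀ x y, A x y = !![l + x, b y; c y, l + x]) : opOfMatrix A = normalOp l b c := by
  funext u
  refine ContinuousLinearMap.ext fun v =>
    ((opOfMatrix_apply A u v).trans ?_).trans (normalOp_apply l b c u v).symm
  rw [h]
  rfl

theorem form₁_eq_normalOp (l : ℝ) : form₁ l = normalOp l 0 0 :=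
  opOfMatrix_eq_normalOp fun _ _ => rfl

theorem form₂_eq_normalOp (l d : ℝ) :
    form₂ l d = normalOp l (fun _ => -(1 / 2)) (fun y => 2 * (y + d)) :=
  opOfMatrix_eq_normalOp fun _ _ => by simp

theorem form₃_eq_normalOp (l s : ℝ) (k : ℕ) : form₃ l s k =
    normalOp l (fun y => -s * ((k : ℝ) / 2) * y ^ (k - 1)) (fun y => (2 / (k : ℝ)) * y) :=
  opOfMatrix_eq_normalOp fun _ _ => by simp

theorem form₄_eq_normalOp (l : ℝ) (g : ℝ → ℝ) : form₄ l (fun z => g z.2) = normalOp l 0 g :=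
  opOfMatrix_eq_normalOp fun _ _ => by simp

theorem hasFDerivAt_comp_coord {b : ℝ → ℝ} {b' : ℝ} {i : Fin 2} {u : Plane}
    (hb : HasDerivAt b b' (u i)) : HasFDerivAt (fun u : Plane => b (u i)) (b' • coord i) u :=
  hb.comp_hasFDerivAt u (hasFDerivAt_coord i u)

variable {l : ℝ} {b c : ℝ → ℝ} {b' c' : ℝ} {u : Plane}

theorem hasFDerivAt_normalOp (hb : HasDerivAt b b' (u 1)) (hc : HasDerivAt c c' (u 1)) :
    HasFDerivAt (normalOp l b c) ((coord 0).smulRight (.id ℝ Plane) +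
      (b' • coord 1).smulRight ((coord 1).smulRight ex) +
      (c' • coord 1).smulRight ((coord 0).smulRight ey)) u :=
  ((((hasFDerivAt_coord 0 u).const_add l).smul_const _).add
    ((hasFDerivAt_comp_coord hb).smul_const _)).add
      ((hasFDerivAt_comp_coord hc).smul_const ((coord 0).smulRight ey))

theorem coordTorsion_normalOp (hb : HasDerivAt b b' (u 1)) (hc : HasDerivAt c c' (u 1))
    (v w : Plane) : coordTorsion (normalOp l b c) u v w =
      ((b' * c (u 1) + b (u 1) * c' - 2 * b (u 1)) * wedge v w) • ex := by
  simp only [coordTorsion, (hasFDerivAt_normalOp hb hc).fderiv, normalOp_apply, wedge_apply]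
  refine plane_ext ?_ ?_ <;>
    simp only [add_apply, smul_apply, ContinuousLinearMap.smulRight_apply,
      ContinuousLinearMap.id_apply, coord_apply, PiLp.add_apply, PiLp.sub_apply, PiLp.smul_apply,
      smul_eq_mul, Matrix.cons_val_zero, Matrix.cons_val_one, Matrix.cons_val_fin_one] <;>
    ring

theorem coordLieDeriv_const (v : Plane) (L : Plane → Plane →L[ℝ] Plane) (u : Plane) :
    coordLieDeriv (fun _ => v) L u = fderiv ℝ L u v := by
  simp [coordLieDeriv]

theorem torsionFreeAt_normalOp_iff (hb : HasDerivAt b b' (u 1)) (hc : HasDerivAt c c' (u 1)) :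
    TorsionFreeAt (M := Plane) (normalOp l b c) u ↔
      b' * c (u 1) + b (u 1) * c' = 2 * b (u 1) := by
  rw [torsionFreeAt_plane_iff (hasFDerivAt_normalOp hb hc).differentiableAt, ← sub_eq_zero]
  simp only [coordTorsion_normalOp hb hc]
  refine ⟨fun h => ?_, fun h v w => by rw [h, zero_mul, zero_smul]⟩
  simpa [wedge_apply] using congrArg (· 0) (h ex ey)

theorem unityAt_normalOp (hb : HasDerivAt b b' (u 1)) (hc : HasDerivAt c c' (u 1)) :
    UnityAt (M := Plane) (normalOp l b c) dX u := by
  have hL := hasFDerivAt_normalOp (l := l) hb hc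
  refine (unityAt_plane_iff hL.differentiableAt).2 ((coordLieDeriv_const ex _ u).trans ?_)
  rw [hL.fderiv]
  ext1 v
  simp

theorem tendsto_coord_nhds_zero (i : Fin 2) :
    Filter.Tendsto (fun u : Plane => u i) (𝓝 0) (𝓝 0) :=
  (coord i).continuous.tendsto' 0 0 (map_zero _)

theorem isModelNearZero_normalOp {b' c' : ℝ → ℝ} (hb : ∀ᶠ y in 𝓝 0, HasDerivAt b (b' y) y)
    (hc : ∀ᶠ y in 𝓝 0, HasDerivAt c (c' y) y)
    (h : ∀ᶠ y in 𝓝 0, b' y * c y + b y * c' y = 2 * b y) :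
    IsModelNearZero (normalOp l b c) := by
  have htendsto := tendsto_coord_nhds_zero 1
  filter_upwards [htendsto.eventually hb, htendsto.eventually hc, htendsto.eventually h]
    with u hbu hcu hu
  exact ⟨(torsionFreeAt_normalOp_iff hbu hcu).2 hu, unityAt_normalOp hbu hcu⟩

theorem isModelNearZero_form₁ (l : ℝ) : IsModelNearZero (form₁ l) := by
  rw [form₁_eq_normalOp]
  have hzero (y : ℝ) : HasDerivAt (0 : ℝ → ℝ) 0 y := hasDerivAt_const y 0
  exact isModelNearZero_normalOp (.of_forall hzero) (.of_forall hzero)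
    (.of_forall fun y => by simp)

theorem isModelNearZero_form₂ (l d : ℝ) : IsModelNearZero (form₂ l d) := by
  rw [form₂_eq_normalOp]
  refine isModelNearZero_normalOp (.of_forall fun y => hasDerivAt_const y _)
    (.of_forall fun y => ((hasDerivAt_id y).add_const d).const_mul 2) (.of_forall fun y => ?_)
  ring

theorem isModelNearZero_form₃ (l s : ℝ) {k : ℕ} (hk : 1 ≤ k) : IsModelNearZero (form₃ l s k) := by
  rw [form₃_eq_normalOp]
  refine isModelNearZero_normalOp
    (.of_forall fun y => (hasDerivAt_pow (k - 1) y).const_mul (-s * ((k : ℝ) / 2)))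
    (.of_forall fun y => (hasDerivAt_id y).const_mul (2 / (k : ℝ))) (.of_forall fun y => ?_)
  obtain ⟨m, rfl⟩ := Nat.exists_eq_add_of_le' hk
  rcases m with _ | m
  · simp only [zero_add, tsub_self, pow_zero, Nat.cast_zero, Nat.cast_one]
    ring
  · simp only [Nat.add_sub_cancel, pow_succ, Nat.cast_add, Nat.cast_one]
    field_simp
    ring

theorem isModelNearZero_form₄ (l : ℝ) {g : ℝ → ℝ} (hg : ∀ᶠ y in 𝓝 0, DifferentiableAt ℝ g y) :
    IsModelNearZero (form₄ l fun z => g z.2) := by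
  rw [form₄_eq_normalOp]
  exact isModelNearZero_normalOp (.of_forall fun y => hasDerivAt_const y 0)
    (hg.mono fun y hy => hy.hasDerivAt) (.of_forall fun y => by simp)

end NormalOp

/-! ### Reduction to diagonal `l + x` -/

section Reduction

theorem tendsto_mk_zero_nhds_zero :
    Filter.Tendsto (fun y : ℝ => (!₂[0, y] : Plane)) (𝓝 0) (𝓝 0) :=
  (analyticAt_mk analyticAt_const analyticAt_id).continuousAt.tendsto.trans_eq
    (congrArg 𝓝 (plane_ext rfl rfl))

theorem eventually_eq_of_fderiv_ex_eq_zero {F : Type*} [NormedAddCommGroup F] [NormedSpace ℝ F]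
    {f : Plane → F} (hf : ∀ᶠ u in 𝓝 0, DifferentiableAt ℝ f u ∧ fderiv ℝ f u ex = 0) :
    ∀ᶠ u in 𝓝 0, f u = f !₂[0, u 1] := by
  obtain ⟨r, hr, hball⟩ := Metric.eventually_nhds_iff_ball.1 hf
  have hproj : Filter.Tendsto (fun u : Plane => (!₂[0, u 1] : Plane)) (𝓝 0) (𝓝 0) :=
    tendsto_mk_zero_nhds_zero.comp (tendsto_coord_nhds_zero 1)
  have hmem : Metric.ball (0 : Plane) r ∈ 𝓝 0 := Metric.ball_mem_nhds 0 hr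
  filter_upwards [hmem, hproj.eventually hmem] with u hu hu'
  have hdir : u - !₂[0, u 1] = u 0 • ex := plane_ext (by simp) (by simp)
  have hderiv {t : ℝ} (ht : t ∈ Set.Icc (0 : ℝ) 1) :
      HasDerivAt (f ∘ AffineMap.lineMap !₂[0, u 1] u) 0 t := by
    obtain ⟨hd, hzero⟩ := hball _ ((convex_ball 0 r).lineMap_mem hu' hu ht)
    have h := hd.hasFDerivAt.comp_hasDerivAt t AffineMap.hasDerivAt_lineMap
    rwa [hdir, map_smul, hzero, smul_zero] at h
  have hconst := constant_of_has_deriv_right_zero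
    (fun t ht => (hderiv ht).continuousAt.continuousWithinAt)
    (fun t ht => (hderiv (Set.Ico_subset_Icc_self ht)).hasDerivWithinAt)
    1 (Set.right_mem_Icc.2 zero_le_one)
  simpa using hconst

theorem apply_ex_eq_apply_ey_of_coordTorsion_eq_zero {A : Plane → Plane →L[ℝ] Plane} {u : Plane}
    (hU : fderiv ℝ A u ex = .id ℝ Plane) (htr : traceCLM Plane (fderiv ℝ A u ey) = 0)
    (hT : coordTorsion A u ex ey = 0) : A u ex 0 = A u ey 1 := by
  have hT1 := congrArg (· 1) hT
  simp only [coordTorsion, PiLp.add_apply, PiLp.sub_apply, hU] at hT1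
  rw [apply_eq_smul_ex_add_smul_ey (fderiv ℝ A u) (A u ex),
    apply_eq_smul_ex_add_smul_ey (fderiv ℝ A u) (A u ey),
    apply_eq_smul_ex_add_smul_ey (A u) (fderiv ℝ A u ey ex), hU] at hT1
  rw [traceCLM_plane] at htr
  simp only [add_apply, smul_apply, ContinuousLinearMap.id_apply, PiLp.add_apply, PiLp.smul_apply,
    PiLp.zero_apply, smul_eq_mul, Matrix.cons_val_one, Matrix.cons_val_fin_one] at hT1
  linear_combination hT1 - (A u ex 1) * htr

variable {A : Plane → Plane →L[ℝ] Plane} {l : ℝ} {u : Plane}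

theorem IsNijenhuisWithUnityAt.fderiv_ex (h : IsNijenhuisWithUnityAt (M := Plane) A dX u) :
    fderiv ℝ A u ex = .id ℝ Plane :=
  (coordLieDeriv_const ex A u).symm.trans
    ((unityAt_plane_iff h.analyticAt_op.differentiableAt).1 h.unity)

theorem eventually_diagonal_eq (h : ∀ᶠ u in 𝓝 0, IsNijenhuisWithUnityAt (M := Plane) A dX u ∧
      traceCLM Plane (A u) = 2 * (l + u 0)) :
    ∀ᶠ u in 𝓝 0, A u ex 0 = l + u 0 ∧ A u ey 1 = l + u 0 := by
  filter_upwards [h, h.eventually_nhds] with u ⟨hu, htrace⟩ hnhds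
  have hA := hu.analyticAt_op.differentiableAt
  have hderiv : HasFDerivAt (fun u => traceCLM Plane (A u)) ((2 : ℝ) • coord 0) u :=
    (((hasFDerivAt_coord 0 u).const_add l).const_mul 2).congr_of_eventuallyEq
      (hnhds.mono fun _ hz => hz.2)
  have hderiv' : traceCLM Plane (fderiv ℝ A u ey) = 0 := by
    have heq := ((traceCLM Plane).hasFDerivAt.comp u hA.hasFDerivAt).unique hderiv
    simpa using congr($heq ey)
  have hdiag := apply_ex_eq_apply_ey_of_coordTorsion_eq_zero hu.fderiv_ex hderiv'
    ((torsionFreeAt_plane_iff hA).1 hu.torsion_free ex ey)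
  rw [traceCLM_plane] at htrace
  constructor <;> linarith

theorem eventually_eq_smul_id_add
    (h : ∀ᶠ u in 𝓝 0, IsNijenhuisWithUnityAt (M := Plane) A dX u) :
    ∀ᶠ u in 𝓝 0, A u = u 0 • .id ℝ Plane + A !₂[0, u 1] := by
  have hderiv : ∀ᶠ u in 𝓝 0, DifferentiableAt ℝ (fun u : Plane => A u - u 0 • .id ℝ Plane) u ∧
      fderiv ℝ (fun u : Plane => A u - u 0 • .id ℝ Plane) u ex = 0 := by
    filter_upwards [h] with u hu
    have hd := hu.analyticAt_op.differentiableAt.hasFDerivAt.fun_sub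
      ((hasFDerivAt_coord 0 u).smul_const (.id ℝ Plane))
    exact ⟨hd.differentiableAt, by simp [hd.fderiv, hu.fderiv_ex]⟩
  filter_upwards [eventually_eq_of_fderiv_ex_eq_zero hderiv] with u hu
  rw [sub_eq_iff_eq_add'.1 hu]
  exact congrArg _ (sub_eq_self.2 (zero_smul ℝ (ContinuousLinearMap.id ℝ Plane)))

theorem exists_eventually_eq_normalOp
    (h : ∀ᶠ u in 𝓝 0, IsNijenhuisWithUnityAt (M := Plane) A dX u ∧
      traceCLM Plane (A u) = 2 * (l + u 0)) :
    ∃ b c : ℝ → ℝ, AnalyticAt ℝ b 0 ∧ AnalyticAt ℝ c 0 ∧ ∀ᶠ u in 𝓝 0, A u = normalOp l b c u := by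
  have hentry (v : Plane) (i : Fin 2) : AnalyticAt ℝ (fun y : ℝ => A !₂[0, y] v i) 0 := by
    have hzero : (!₂[0, 0] : Plane) = 0 := plane_ext rfl rfl
    have hA : AnalyticAt ℝ A !₂[0, 0] := hzero ▸ h.self_of_nhds.1.analyticAt_op
    have hcurve := hA.fun_comp (f := fun y : ℝ => !₂[0, y])
      (analyticAt_mk analyticAt_const analyticAt_id)
    exact (analyticAt_coord i _).fun_comp
      (((ContinuousLinearMap.apply ℝ Plane v).analyticAt _).fun_comp hcurve)
  refine ⟨_, _, hentry ey 0, hentry ex 1, ?_⟩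
  filter_upwards [eventually_diagonal_eq h, eventually_eq_smul_id_add (h.mono fun _ => And.left)]
    with u ⟨hdiag, hdiag'⟩ hconst
  have hb : A u ey 0 = A !₂[0, u 1] ey 0 := by simpa using congr($hconst ey 0)
  have hc : A u ex 1 = A !₂[0, u 1] ex 1 := by simpa using congr($hconst ex 1)
  ext1 v
  rw [apply_eq_smul_ex_add_smul_ey (A u), normalOp_apply, ← hb, ← hc]
  refine plane_ext ?_ ?_ <;>
    simp only [PiLp.add_apply, PiLp.smul_apply, smul_eq_mul, hdiag, hdiag', Matrix.cons_val_zero,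
      Matrix.cons_val_one, Matrix.cons_val_fin_one] <;>
    ring

theorem eventually_deriv_mul_eq_two_mul {b c : ℝ → ℝ} (hb : AnalyticAt ℝ b 0)
    (hc : AnalyticAt ℝ c 0) (hT : ∀ᶠ u in 𝓝 0, TorsionFreeAt (M := Plane) (normalOp l b c) u) :
    ∀ᶠ y in 𝓝 0, deriv (fun y => b y * c y) y = 2 * b y := by
  filter_upwards [tendsto_mk_zero_nhds_zero.eventually hT, hb.eventually_analyticAt,
    hc.eventually_analyticAt] with y hy hby hcy
  have hby := hby.differentiableAt
  have hcy := hcy.differentiableAt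
  rw [deriv_fun_mul hby hcy]
  exact (torsionFreeAt_normalOp_iff (u := !₂[0, y]) hby.hasDerivAt hcy.hasDerivAt).1 hy

theorem torsionFreeAt_congr {B : Plane → Plane →L[ℝ] Plane} (hA : DifferentiableAt ℝ A u)
    (h : A =ᶠ[𝓝 u] B) (hT : TorsionFreeAt (M := Plane) A u) : TorsionFreeAt (M := Plane) B u := by
  rw [torsionFreeAt_plane_iff (hA.congr_of_eventuallyEq h.symm)]
  rw [torsionFreeAt_plane_iff hA] at hT
  simpa only [coordTorsion, h.fderiv_eq, h.self_of_nhds] using hT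

variable {M : Type*} [TopologicalSpace M] [ChartedSpace Plane M] [IsManifold (𝓡 2) ω M]
  {L : OpField M} {e : VField M} {p : M}

theorem exists_pairEquiv_normalOp (h : ∀ᶠ q in 𝓝 p, IsNijenhuisWithUnityAt L e q) :
    ∃ (l : ℝ) (b c : ℝ → ℝ), PairEquiv L e p (normalOp l b c) dX 0 ∧ AnalyticAt ℝ b 0 ∧
      AnalyticAt ℝ c 0 ∧ ∀ᶠ y in 𝓝 0, deriv (fun y => b y * c y) y = 2 * b y := by
  obtain ⟨l, A, hequiv, hA⟩ := exists_pairEquiv_dX h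
  obtain ⟨b, c, hb, hc, heq⟩ := exists_eventually_eq_normalOp hA
  refine ⟨l, b, c, hequiv.congr_right heq (.of_forall fun _ => rfl), hb, hc,
    eventually_deriv_mul_eq_two_mul (l := l) hb hc ?_⟩
  filter_upwards [hA, heq.eventually_nhds] with u hu hnhds
  exact torsionFreeAt_congr hu.1.analyticAt_op.differentiableAt hnhds hu.1.torsion_free

end Reduction

/-! ### Normal forms -/

section NormalForms

variable {l : ℝ} {b c b' c' φ : ℝ → ℝ}

theorem fderiv_mk_comp_coord_apply {φ' : ℝ} {u : Plane} (hφ : HasDerivAt φ φ' (u 1)) (v : Plane) :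
    fderiv ℝ (fun u : Plane => (!₂[u 0, φ (u 1)] : Plane)) u v = !₂[v 0, φ' * v 1] := by
  have hφ₁ := hasFDerivAt_comp_coord hφ
  rw [fderiv_mk_apply (hasFDerivAt_coord 0 u).differentiableAt hφ₁.differentiableAt,
    (hasFDerivAt_coord 0 u).fderiv, hφ₁.fderiv]
  simp

theorem pairEquiv_normalOp (hφ : AnalyticAt ℝ φ 0) (hφ0 : φ 0 = 0) (hφd : deriv φ 0 ≠ 0)
    (hb : ∀ᶠ y in 𝓝 0, b y = deriv φ y * b' (φ y))
    (hc : ∀ᶠ y in 𝓝 0, deriv φ y * c y = c' (φ y)) :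
    PairEquiv (M := Plane) (normalOp l b c) dX 0 (normalOp l b' c') dX 0 := by
  have hy := tendsto_coord_nhds_zero 1
  have hφ₁ : ∀ᶠ u : Plane in 𝓝 0, HasDerivAt φ (deriv φ (u 1)) (u 1) :=
    hy.eventually (hφ.eventually_analyticAt.mono fun _ h => h.differentiableAt.hasDerivAt)
  refine PairEquiv.of_eventually (F := fun u : Plane => !₂[u 0, φ (u 1)])
    (analyticAt_mk (analyticAt_coord 0 _) (hφ.fun_comp (f := fun u : Plane => u 1)
      (analyticAt_coord 1 0))) (plane_ext rfl hφ0) ?_ ?_ ?_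
  · refine (injective_iff_map_eq_zero _).2 fun v hv => ?_
    rw [fderiv_mk_comp_coord_apply hφ₁.self_of_nhds] at hv
    exact plane_ext congr($hv 0) ((mul_eq_zero.1 congr($hv 1)).resolve_left hφd)
  · filter_upwards [hφ₁, hy.eventually hb, hy.eventually hc] with u hu hbu hcu v
    refine (congrArg _ (normalOp_apply l b c u v)).trans <|
      (fderiv_mk_comp_coord_apply hu _).trans <| .trans (plane_ext ?_ ?_) <|
      (normalOp_apply l b' c' _ _).symm.trans <|
      congrArg (normalOp l b' c' _) (fderiv_mk_comp_coord_apply hu v).symm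
    · simp only [Matrix.cons_val_zero, Matrix.cons_val_one, Matrix.cons_val_fin_one, hbu]
      ring
    · simp only [Matrix.cons_val_zero, Matrix.cons_val_one, Matrix.cons_val_fin_one]
      linear_combination v 0 * hcu
  · filter_upwards [hφ₁] with u hu
    exact (fderiv_mk_comp_coord_apply hu _).trans (plane_ext rfl (mul_zero _))

theorem pairEquiv_form₂ (hb : AnalyticAt ℝ b 0) (hc : AnalyticAt ℝ c 0)
    (h : ∀ᶠ y in 𝓝 0, deriv (fun y => b y * c y) y = 2 * b y) (h0 : b 0 ≠ 0) :
    PairEquiv (M := Plane) (normalOp l b c) dX 0 (form₂ l (-(b 0 * c 0))) dX 0 := by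
  let φ : ℝ → ℝ := fun y => b 0 * c 0 - b y * c y
  have hφ : ∀ᶠ y in 𝓝 0, deriv φ y = -2 * b y := h.mono fun y hy => by
    rw [deriv_const_sub, hy, neg_mul]
  rw [form₂_eq_normalOp]
  refine pairEquiv_normalOp (φ := φ) (analyticAt_const.sub (hb.mul hc)) (sub_self _) ?_ ?_ ?_
  · simpa [hφ.self_of_nhds] using h0
  · filter_upwards [hφ] with y hy
    linear_combination (1 / 2) * hy
  · filter_upwards [hφ] with y hy
    linear_combination c y * hy

theorem exists_analyticAt_pow_eq {g : ℝ → ℝ} {y₀ : ℝ} (hg : AnalyticAt ℝ g y₀) (h0 : 0 < g y₀)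
    {k : ℕ} (hk : k ≠ 0) :
    ∃ ρ : ℝ → ℝ, AnalyticAt ℝ ρ y₀ ∧ ρ y₀ ≠ 0 ∧ ∀ᶠ y in 𝓝 y₀, ρ y ^ k = g y := by
  refine ⟨fun y => Real.exp (Real.log (g y) / k), (hg.log h0).div_const.rexp',
    Real.exp_ne_zero _, ?_⟩
  filter_upwards [hg.continuousAt.eventually (lt_mem_nhds h0)] with y hy
  rw [← Real.exp_nat_mul, mul_div_cancel₀ _ (Nat.cast_ne_zero.2 hk), Real.exp_log hy]

theorem exists_eventually_eq_neg_sign_mul_pow {D : ℝ → ℝ} (hD : AnalyticAt ℝ D 0) (hD0 : D 0 = 0)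
    (hne : ¬ ∀ᶠ y in 𝓝 0, D y = 0) :
    ∃ (s : ℝ) (k : ℕ) (φ : ℝ → ℝ), (s = 1 ∨ s = -1) ∧ 1 ≤ k ∧ AnalyticAt ℝ φ 0 ∧ φ 0 = 0 ∧
      deriv φ 0 ≠ 0 ∧ ∀ᶠ y in 𝓝 0, D y = -s * φ y ^ k := by
  obtain ⟨k, g, hg, hg0, hgD⟩ := hD.exists_eventuallyEq_pow_smul_nonzero_iff.2 hne
  have hk : k ≠ 0 := by
    rintro rfl
    exact hg0 (by simpa [hD0] using hgD.self_of_nhds.symm)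
  obtain ⟨s, hs, hsg⟩ : ∃ s : ℝ, (s = 1 ∨ s = -1) ∧ 0 < -s * g 0 := by
    rcases lt_or_gt_of_ne hg0 with h | h
    · exact ⟨1, .inl rfl, by linarith⟩
    · exact ⟨-1, .inr rfl, by linarith⟩
  obtain ⟨ρ, hρ, hρ0, hρk⟩ := exists_analyticAt_pow_eq (analyticAt_const.fun_mul hg) hsg hk
  have hderiv := (hasDerivAt_id (0 : ℝ)).fun_mul hρ.differentiableAt.hasDerivAt
  refine ⟨s, k, fun y => y * ρ y, hs, Nat.one_le_iff_ne_zero.2 hk, analyticAt_id.mul hρ,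
    zero_mul _, ?_, ?_⟩
  · exact hderiv.deriv.trans_ne (by simpa using hρ0)
  · have hs2 : s * s = 1 := by rcases hs with rfl | rfl <;> norm_num
    filter_upwards [hgD, hρk] with y hy hρy
    rw [hy, mul_pow, hρy, sub_zero, smul_eq_mul]
    linear_combination (-y ^ k * g y) * hs2

theorem not_eventually_mul_eq_zero (h : ∀ᶠ y in 𝓝 0, deriv (fun y => b y * c y) y = 2 * b y)
    (hb : ¬ ∀ᶠ y in 𝓝 0, b y = 0) : ¬ ∀ᶠ y in 𝓝 0, b y * c y = 0 := by
  refine fun hzero => hb ?_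
  filter_upwards [h, hzero.eventually_nhds] with y hy hnhds
  rw [Filter.EventuallyEq.deriv_eq (f := fun _ => 0) hnhds, deriv_const] at hy
  linarith

theorem eventually_eq_deriv_mul_pow {s : ℝ} {k : ℕ} (hφ : AnalyticAt ℝ φ 0)
    (h : ∀ᶠ y in 𝓝 0, deriv (fun y => b y * c y) y = 2 * b y)
    (hbc : ∀ᶠ y in 𝓝 0, b y * c y = -s * φ y ^ k) :
    ∀ᶠ y in 𝓝 0, b y = deriv φ y * (-s * ((k : ℝ) / 2) * φ y ^ (k - 1)) := by
  filter_upwards [h, hbc.eventually_nhds, hφ.eventually_analyticAt] with y hy hnhds hφy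
  have hpow := (hφy.differentiableAt.hasDerivAt.fun_pow k).const_mul (-s)
  rw [Filter.EventuallyEq.deriv_eq hnhds, hpow.deriv] at hy
  linear_combination -hy / 2

theorem eventually_deriv_mul_eq {s : ℝ} {k : ℕ} (hs : s ≠ 0) (hk : 1 ≤ k) (hφ : AnalyticAt ℝ φ 0)
    (hφd : deriv φ 0 ≠ 0) (hc : AnalyticAt ℝ c 0)
    (hb : ∀ᶠ y in 𝓝 0, b y = deriv φ y * (-s * ((k : ℝ) / 2) * φ y ^ (k - 1)))
    (hbc : ∀ᶠ y in 𝓝 0, b y * c y = -s * φ y ^ k) :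
    ∀ᶠ y in 𝓝 0, deriv φ y * c y = 2 / (k : ℝ) * φ y := by
  have hk' : (k : ℝ) ≠ 0 := Nat.cast_ne_zero.2 (Nat.one_le_iff_ne_zero.1 hk)
  refine ((hφ.deriv.fun_mul hc).continuousAt.eventuallyEq_nhds_iff_eventuallyEq_nhdsNE
    (analyticAt_const.fun_mul hφ).continuousAt).1 ?_
  filter_upwards [hφ.differentiableAt.hasDerivAt.eventually_ne (c := 0) hφd,
    hb.filter_mono nhdsWithin_le_nhds, hbc.filter_mono nhdsWithin_le_nhds] with y hne hby hbcy
  rw [hby, ← pow_sub_one_mul (Nat.one_le_iff_ne_zero.1 hk) (φ y)] at hbcy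
  field_simp
  refine mul_left_cancel₀ (mul_ne_zero hs (pow_ne_zero (k - 1) hne)) ?_
  linear_combination -2 * hbcy

theorem exists_pairEquiv_form₃ (hb : AnalyticAt ℝ b 0) (hc : AnalyticAt ℝ c 0)
    (h : ∀ᶠ y in 𝓝 0, deriv (fun y => b y * c y) y = 2 * b y)
    (hb_ne : ¬ ∀ᶠ y in 𝓝 0, b y = 0) (h0 : b 0 * c 0 = 0) :
    ∃ (s : ℝ) (k : ℕ), (s = 1 ∨ s = -1) ∧ 1 ≤ k ∧
      PairEquiv (M := Plane) (normalOp l b c) dX 0 (form₃ l s k) dX 0 := by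
  obtain ⟨s, k, φ, hs, hk, hφ, hφ0, hφd, hbc⟩ := exists_eventually_eq_neg_sign_mul_pow
    (hb.fun_mul hc) h0 (not_eventually_mul_eq_zero h hb_ne)
  have hs0 : s ≠ 0 := by rcases hs with rfl | rfl <;> norm_num
  have hbφ := eventually_eq_deriv_mul_pow hφ h hbc
  refine ⟨s, k, hs, hk, ?_⟩
  rw [form₃_eq_normalOp]
  exact pairEquiv_normalOp hφ hφ0 hφd hbφ (eventually_deriv_mul_eq hs0 hk hφ hφd hc hbφ hbc)

theorem pairEquiv_form₄ (hb : ∀ᶠ y in 𝓝 0, b y = 0) :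
    PairEquiv (M := Plane) (normalOp l b c) dX 0 (form₄ l fun z => c z.2) dX 0 := by
  rw [form₄_eq_normalOp]
  exact pairEquiv_normalOp (φ := id) analyticAt_id rfl (by simp) (by simpa using hb) (by simp)

variable {M : Type*} [TopologicalSpace M] [ChartedSpace Plane M] [IsManifold (𝓡 2) ω M]
  {L : OpField M} {e : VField M} {p : M}

theorem exists_normal_form (h : ∀ᶠ q in 𝓝 p, IsNijenhuisWithUnityAt L e q) : ∃ l : ℝ,
    PairEquiv L e p (form₁ l) dX 0 ∨
    (∃ d : ℝ, PairEquiv L e p (form₂ l d) dX 0) ∨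
    (∃ (s : ℝ) (k : ℕ), (s = 1 ∨ s = -1) ∧ 1 ≤ k ∧ PairEquiv L e p (form₃ l s k) dX 0) ∨
    (∃ g : ℝ → ℝ, AnalyticAt ℝ g 0 ∧ PairEquiv L e p (form₄ l fun z => g z.2) dX 0) := by
  obtain ⟨l, b, c, hequiv, hb, hc, hbc⟩ := exists_pairEquiv_normalOp h
  refine ⟨l, .inr ?_⟩
  by_cases hb_zero : ∀ᶠ y in 𝓝 0, b y = 0
  · exact .inr (.inr ⟨c, hc, hequiv.trans (pairEquiv_form₄ hb_zero)⟩)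
  by_cases h0 : b 0 * c 0 = 0
  · obtain ⟨s, k, hs, hk, h₃⟩ := exists_pairEquiv_form₃ (l := l) hb hc hbc hb_zero h0
    exact .inr (.inl ⟨s, k, hs, hk, hequiv.trans h₃⟩)
  · exact .inl ⟨_, hequiv.trans (pairEquiv_form₂ hb hc hbc (left_ne_zero_of_mul h0))⟩

end NormalForms

/-! ### Equivalence of operators of the fourth form -/

section Equivalence

variable {l : ℝ} {f f' h : ℝ × ℝ → ℝ}

theorem form₄_apply (l : ℝ) (f : ℝ × ℝ → ℝ) (u v : Plane) : form₄ l f u v =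
    (!₂[(l + u 0) * v 0, f (u 0, u 1) * v 0 + (l + u 0) * v 1] : Plane) :=
  (opOfMatrix_apply _ u v).trans (plane_ext (by simp) (by simp))

theorem fderiv_apply_eq_deriv_snd {z : ℝ × ℝ} (hh : DifferentiableAt ℝ h z) :
    fderiv ℝ h z (0, 1) = deriv (fun t => h (z.1, t)) z.2 :=
  (hh.hasFDerivAt.comp_hasDerivAt (f := fun t : ℝ => (z.1, t)) z.2
    ((hasDerivAt_const _ _).prodMk (hasDerivAt_id _))).deriv.symm

theorem tendsto_mk_coord_nhds_zero :
    Filter.Tendsto (fun u : Plane => (u 0, u 1)) (𝓝 0) (𝓝 (0, 0)) :=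
  (tendsto_coord_nhds_zero 0).prodMk_nhds (tendsto_coord_nhds_zero 1)

theorem fderiv_mk_coord_apply {u : Plane} (hh : DifferentiableAt ℝ h (u 0, u 1)) (v : Plane) :
    fderiv ℝ (fun u : Plane => (!₂[u 0, h (u 0, u 1)] : Plane)) u v =
      !₂[v 0, fderiv ℝ h (u 0, u 1) (1, 0) * v 0 + deriv (fun t => h (u 0, t)) (u 1) * v 1] := by
  have hprod := (hasFDerivAt_coord 0 u).prodMk (hasFDerivAt_coord 1 u)
  have hcomp : HasFDerivAt (fun u : Plane => h (u 0, u 1)) _ u := hh.hasFDerivAt.comp u hprod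
  rw [fderiv_mk_apply (hasFDerivAt_coord 0 u).differentiableAt hcomp.differentiableAt]
  refine plane_ext congr($((hasFDerivAt_coord 0 u).fderiv) v) (congr($hcomp.fderiv v).trans ?_)
  have hv : (v 0, v 1) = v 0 • ((1 : ℝ), (0 : ℝ)) + v 1 • ((0 : ℝ), (1 : ℝ)) := by simp
  refine (congrArg (fderiv ℝ h (u 0, u 1)) hv).trans ?_
  rw [map_add, map_smul, map_smul, fderiv_apply_eq_deriv_snd hh]
  simp [mul_comm]

theorem ParamEquiv.opEquiv_form₄ (hff' : ParamEquiv f f') (l : ℝ) :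
    OpEquiv (form₄ l f) 0 (form₄ l f') 0 := by
  obtain ⟨h, hh, hh0, hhd, heq⟩ := hff'
  have hF := analyticAt_mk (analyticAt_coord 0 0)
    (hh.fun_comp_of_eq ((analyticAt_coord 0 0).prod (analyticAt_coord 1 0)) rfl)
  refine OpEquiv.of_eventually hF (plane_ext rfl hh0) ?_ ?_
  · refine (injective_iff_map_eq_zero _).2 fun v hv => ?_
    rw [fderiv_mk_coord_apply hh.differentiableAt] at hv
    have hv0 : v 0 = 0 := congr($hv 0)
    have hv1 : _ * v 0 + _ * v 1 = 0 := congr($hv 1)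
    rw [hv0, mul_zero, zero_add] at hv1
    exact plane_ext hv0 ((mul_eq_zero.1 hv1).resolve_left hhd)
  · filter_upwards [tendsto_mk_coord_nhds_zero.eventually hh.eventually_analyticAt,
      tendsto_mk_coord_nhds_zero.eventually heq] with u hhu hu v
    have hd := fderiv_mk_coord_apply hhu.differentiableAt
    refine (congrArg _ (form₄_apply l f u v)).trans <| (hd _).trans <| .trans (plane_ext ?_ ?_) <|
      (form₄_apply l f' _ _).symm.trans <| congrArg (form₄ l f' _) (hd v).symm
    · simp
    · simp only [Matrix.cons_val_zero, Matrix.cons_val_one, Matrix.cons_val_fin_one]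
      linear_combination -v 0 * hu

theorem ParamEquiv.pairEquiv_form₄ {g g' : ℝ → ℝ}
    (h : ParamEquiv (fun z => g z.2) (fun z => g' z.2)) (l : ℝ) :
    PairEquiv (form₄ l fun z => g z.2) dX 0 (form₄ l fun z => g' z.2) dX 0 := by
  obtain ⟨h, hh, hh0, hhd, heq⟩ := h
  have hι : AnalyticAt ℝ (fun t : ℝ => ((0 : ℝ), t)) 0 := analyticAt_const.prod analyticAt_id
  rw [form₄_eq_normalOp, form₄_eq_normalOp]
  refine pairEquiv_normalOp (φ := fun t => h (0, t)) (hh.fun_comp_of_eq hι rfl) hh0 hhd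
    (by simp) ?_
  filter_upwards [hι.continuousAt.eventually heq] with y hy
  exact hy.symm

variable {Φ : OpenPartialHomeomorph Plane Plane} {u₀ u₁ u : Plane}

theorem traceCLM_form₄ (l : ℝ) (f : ℝ × ℝ → ℝ) (u : Plane) :
    traceCLM Plane (form₄ l f u) = 2 * (l + u 0) := by
  refine (traceCLM_plane _).trans <| (congrArg₂ (fun v w : Plane => v 0 + w 1)
    (form₄_apply l f u ex) (form₄_apply l f u ey)).trans ?_
  simp [two_mul]

theorem IsLocalAnalyticDiffeo.analyticAt (hΦ : IsLocalAnalyticDiffeo Φ u₀ u₁)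
    (hu : u ∈ Φ.source) : AnalyticAt ℝ Φ u :=
  (contMDiffAt_iff_contDiffAt.1 (hΦ.contMDiffAt hu)).analyticAt

theorem MapsOp.apply_zero_eq (hL : MapsOp Φ (form₄ l f) (form₄ l f'))
    (hΦ : IsLocalAnalyticDiffeo Φ u₀ u₁) (hu : u ∈ Φ.source) : Φ u 0 = u 0 := by
  have htrace := hL.traceCLM_eq hΦ hu
  rw [traceCLM_form₄, traceCLM_form₄] at htrace
  linarith

theorem MapsOp.fderiv_apply_zero_eq (hL : MapsOp Φ (form₄ l f) (form₄ l f'))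
    (hΦ : IsLocalAnalyticDiffeo Φ u₀ u₁) (hu : u ∈ Φ.source) (v : Plane) :
    fderiv ℝ Φ u v 0 = v 0 := by
  have hd := (hasFDerivAt_coord 0 (Φ u)).comp u (hΦ.analyticAt hu).differentiableAt.hasFDerivAt
  have hx : (fun u => Φ u 0) =ᶠ[𝓝 u] fun u => u 0 :=
    Filter.eventually_of_mem (Φ.open_source.mem_nhds hu) fun _ h => hL.apply_zero_eq hΦ h
  exact congr($(hd.unique ((hasFDerivAt_coord 0 u).congr_of_eventuallyEq hx)) v)

theorem MapsOp.apply_eq_fderiv_mul (hL : MapsOp Φ (form₄ l f) (form₄ l f'))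
    (hΦ : IsLocalAnalyticDiffeo Φ u₀ u₁) (hu : u ∈ Φ.source) :
    f' (u 0, Φ u 1) = fderiv ℝ Φ u ey 1 * f (u 0, u 1) := by
  have hcomm : fderiv ℝ Φ u (form₄ l f u ex) = form₄ l f' (Φ u) (fderiv ℝ Φ u ex) :=
    mfderiv_eq_fderiv (𝕜 := ℝ) (f := Φ) (x := u) ▸ hL u hu ex
  have hleft := (congrArg (fderiv ℝ Φ u) (form₄_apply l f u ex)).trans
    (apply_eq_smul_ex_add_smul_ey _ _)
  have h1 := congr($(hleft.symm.trans (hcomm.trans (form₄_apply l f' _ _))) 1)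
  simp only [PiLp.add_apply, PiLp.smul_apply, smul_eq_mul, Matrix.cons_val_zero,
    Matrix.cons_val_one, Matrix.cons_val_fin_one, hL.apply_zero_eq hΦ hu,
    hL.fderiv_apply_zero_eq hΦ hu] at h1
  linear_combination -h1

theorem MapsOp.fderiv_ey_one_ne_zero (hL : MapsOp Φ (form₄ l f) (form₄ l f'))
    (hΦ : IsLocalAnalyticDiffeo Φ u₀ u₁) (hu : u ∈ Φ.source) :
    fderiv ℝ Φ u ey 1 ≠ 0 := by
  intro hzero
  have hinj : Function.Injective (fderiv ℝ Φ u) :=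
    mfderiv_eq_fderiv (𝕜 := ℝ) (f := Φ) (x := u) ▸ (hΦ.isInvertible_mfderiv hu).injective
  have hey : fderiv ℝ Φ u ey = 0 := plane_ext (hL.fderiv_apply_zero_eq hΦ hu ey) hzero
  simpa using congr($((injective_iff_map_eq_zero _).1 hinj ey hey) 1)

theorem deriv_comp_mk {z : ℝ × ℝ} {Ψ : Plane → Plane} (h : DifferentiableAt ℝ Ψ !₂[z.1, z.2]) :
    deriv (fun t => Ψ !₂[z.1, t] 1) z.2 = fderiv ℝ Ψ !₂[z.1, z.2] ey 1 := by
  have hline : HasDerivAt (fun t : ℝ => (!₂[z.1, t] : Plane)) ey z.2 := by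
    exact (hasFDerivAt_mk (hasFDerivAt_const z.1 z.2) (hasFDerivAt_id z.2)).hasDerivAt.congr_deriv
      (plane_ext (by simp) (by simp))
  exact ((hasFDerivAt_coord 1 _).comp_hasDerivAt z.2 (h.hasFDerivAt.comp_hasDerivAt
    (f := fun t : ℝ => (!₂[z.1, t] : Plane)) z.2 hline)).deriv

theorem OpEquiv.paramEquiv (h : OpEquiv (form₄ l f) 0 (form₄ l f') 0) : ParamEquiv f f' := by
  obtain ⟨Φ, hΦ, hL⟩ := h
  let ι : ℝ × ℝ → Plane := fun z => !₂[z.1, z.2]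
  have hι : AnalyticAt ℝ ι (0, 0) := analyticAt_mk analyticAt_fst analyticAt_snd
  have hι0 : ι (0, 0) = 0 := plane_ext rfl rfl
  have hmem : ι (0, 0) ∈ Φ.source := hι0 ▸ hΦ.mem_source
  have hΦι : ∀ z, ι z ∈ Φ.source →
      deriv (fun t => Φ (ι (z.1, t)) 1) z.2 = fderiv ℝ Φ (ι z) ey 1 :=
    fun z hz => deriv_comp_mk (hΦ.analyticAt hz).differentiableAt
  refine ⟨fun z => Φ (ι z) 1, ?_, ?_, ?_, ?_⟩
  · exact (analyticAt_coord 1 _).fun_comp ((hΦ.analyticAt hmem).fun_comp hι)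
  · simp [hι0, hΦ.map_point]
  · exact (hΦι (0, 0) hmem).trans_ne (hL.fderiv_ey_one_ne_zero hΦ hmem)
  · filter_upwards [hι.continuousAt.eventually (Φ.open_source.mem_nhds hmem)] with z hz
    rw [hΦι z hz]
    exact hL.apply_eq_fderiv_mul hΦ hz

end Equivalence

end NijenhuisUnity

end

open NijenhuisUnity in
theorem mainTheorem4_general :
    (∀ (M : Type*) [TopologicalSpace M] [ChartedSpace Plane M] [IsManifold (𝓡 2) ω M]
        (L : OpField M) (e : VField M) (p : M), (∀ᶠ q in 𝓝 p, IsNijenhuisWithUnityAt L e q) →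
      ∃ l : ℝ,
        PairEquiv L e p (form₁ l) dX 0 ∨
        (∃ d : ℝ, PairEquiv L e p (form₂ l d) dX 0) ∨
        (∃ (s : ℝ) (k : ℕ), (s = 1 ∨ s = -1) ∧ 1 ≤ k ∧ PairEquiv L e p (form₃ l s k) dX 0) ∨
        (∃ g : ℝ → ℝ, AnalyticAt ℝ g 0 ∧ PairEquiv L e p (form₄ l fun z => g z.2) dX 0)) ∧
    (∀ l : ℝ, IsModelNearZero (form₁ l) ∧
      (∀ d : ℝ, IsModelNearZero (form₂ l d)) ∧
      (∀ (s : ℝ) (k : ℕ), 1 ≤ k → IsModelNearZero (form₃ l s k)) ∧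
      (∀ g : ℝ → ℝ, (∀ᶠ y in 𝓝 0, DifferentiableAt ℝ g y) →
        IsModelNearZero (form₄ l fun z => g z.2))) ∧
    (∀ (l : ℝ) (f f' : ℝ × ℝ → ℝ), OpEquiv (form₄ l f) 0 (form₄ l f') 0 ↔ ParamEquiv f f') ∧
    (∀ (l : ℝ) (g g' : ℝ → ℝ),
      PairEquiv (form₄ l fun z => g z.2) dX 0 (form₄ l fun z => g' z.2) dX 0 ↔
        ParamEquiv (fun z => g z.2) (fun z => g' z.2)) :=
  ⟨fun _ _ _ _ _ _ _ h => exists_normal_form h,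
    fun l => ⟨isModelNearZero_form₁ l, isModelNearZero_form₂ l,
      fun s _ hk => isModelNearZero_form₃ l s hk, fun _ hg => isModelNearZero_form₄ l hg⟩,
    fun l _ _ => ⟨OpEquiv.paramEquiv, fun h => h.opEquiv_form₄ l⟩,
    fun l _ _ => ⟨fun h => h.opEquiv.paramEquiv, fun h => h.pairEquiv_form₄ l⟩⟩

open NijenhuisUnity in
theorem mainTheorem4 :
    -- every pair can be brought to one of the four forms
    (∀ (M : Type*) [TopologicalSpace M] [ChartedSpace Plane M] [IsManifold (𝓡 2) ω M]
        (L : OpField M) (e : VField M), IsNijenhuisWithUnity L e → ∀ p : M, ∃ l : ℝ,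
      PairEquiv L e p (form₁ l) dX 0 ∨
      (∃ d : ℝ, PairEquiv L e p (form₂ l d) dX 0) ∨
      (∃ (s : ℝ) (k : ℕ), (s = 1 ∨ s = -1) ∧ 1 ≤ k ∧ PairEquiv L e p (form₃ l s k) dX 0) ∨
      (∃ g : ℝ → ℝ, AnalyticAt ℝ g 0 ∧ PairEquiv L e p (form₄ l fun z => g z.2) dX 0)) ∧
    -- all these forms do occur, with arbitrary parameters
    (∀ l : ℝ, IsModelNearZero (form₁ l) ∧
      (∀ d : ℝ, IsModelNearZero (form₂ l d)) ∧
      (∀ (s : ℝ) (k : ℕ), (s = 1 ∨ s = -1) → 1 ≤ k → IsModelNearZero (form₃ l s k)) ∧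
      (∀ g : ℝ → ℝ, AnalyticAt ℝ g 0 → IsModelNearZero (form₄ l fun z => g z.2))) ∧
    -- equivalence of operators of the fourth form, for functions of both variables
    (∀ (l : ℝ) (f f' : ℝ × ℝ → ℝ), AnalyticAt ℝ f (0, 0) → AnalyticAt ℝ f' (0, 0) →
      (OpEquiv (form₄ l f) 0 (form₄ l f') 0 ↔ ParamEquiv f f')) ∧
    -- equivalence of pairs of the fourth form
    (∀ (l : ℝ) (g g' : ℝ → ℝ), AnalyticAt ℝ g 0 → AnalyticAt ℝ g' 0 →
      (PairEquiv (form₄ l fun z => g z.2) dX 0 (form₄ l fun z => g' z.2) dX 0 ↔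
        ParamEquiv (fun z => g z.2) (fun z => g' z.2))) := by
  obtain ⟨hforms, hmodels, hop, hpair⟩ := mainTheorem4_general
  refine ⟨fun M _ _ _ L e h p => hforms M L e p (.of_forall h.isNijenhuisWithUnityAt), fun l => ?_,
    fun l f f' _ _ => hop l f f', fun l g g' _ _ => hpair l g g'⟩
  obtain ⟨h₁, h₂, h₃, h₄⟩ := hmodels l
  exact ⟨h₁, h₂, fun s k _ => h₃ s k,
    fun g hg => h₄ g (hg.eventually_analyticAt.mono fun _ h => h.differentiableAt)⟩
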